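/- Let $\mathbf{W}^*_{\mathrm{NMIU}}$, $\mathbf{W}^*_{\mathrm{NPU}}$ and $\mathbf{W}^*_{\mathrm{NCPsU}}$ be the categories whose objects are the von Neumann algebras ($W^*$-algebras, including the zero algebra) and whose morphisms are, respectively, the normal unital $*$-homomorphisms, the normal positive unital linear maps, and the normal completely positive linear maps $f$ with $f(1)\le 1$. Here a map is normal if it preserves suprema of upwards directed (non-empty) sets of self-adjoint elements. A functor $F\colon\mathbf{C}\to\mathbf{D}$ is called Kleislian if it has a right adjoint $U$ and the comparison functor $L\colon\mathcal{K}\ell(UF)\to\mathbf{D}$, given by $LX=FX$ and $L(f\colon X\to UFY)=\varepsilon_{FY}\circ Ff$ with $\varepsilon$ the counit, is an isomorphism of categories; $\mathbf{D}$ is Kleislian over $\mathbf{C}$ if there is a Kleislian functor $\mathbf{C}\to\mathbf{D}$. 1. The inclusion $U\colon\mathbf{W}^*_{\mathrm{NMIU}}\to\mathbf{W}^*_{\mathrm{NPU}}$ has a left adjoint, and $U^{\mathrm{op}}$ is Kleislian; hence $(\mathbf{W}^*_{\mathrm{NPU}})^{\mathrm{op}}$ is Kleislian over $(\mathbf{W}^*_{\mathrm{NMIU}})^{\mathrm{op}}$.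 2. The inclusion $U'\colon\mathbf{W}^*_{\mathrm{NMIU}}\to\mathbf{W}^*_{\mathrm{NCPsU}}$ has a left adjoint, and $(U')^{\mathrm{op}}$ is Kleislian; hence $(\mathbf{W}^*_{\mathrm{NCPsU}})^{\mathrm{op}}$ is Kleislian over $(\mathbf{W}^*_{\mathrm{NMIU}})^{\mathrm{op}}$. 3. Let $\mathscr{B}\subseteq\mathscr{B}(\mathscr{H})$ be a von Neumann algebra on a Hilbert space $\mathscr{H}$ and let $X\subseteq\mathscr{B}$ be an infinite subset. Then there is a smallest von Neumann subalgebra $\mathscr{B}'$ of $\mathscr{B}$ (with the same unit) that contains $X$, and $\#\mathscr{B}'\le\#\wp(\wp(X))$. 4. (Solution sets.) Every normal positive unital map $f\colon\mathscr{A}\to\mathscr{B}$ between von Neumann algebras factors as $f=h\circ c$ with $c\colon\mathscr{A}\to\mathscr{C}$ a normal positive unital map, $h\colon\mathscr{C}\to\mathscr{B}$ a normal unital $*$-homomorphism and $\mathscr{C}$ a von Neumann algebra with $\#\mathscr{C}\le\#\wp(\wp(\mathscr{A}))$. If $\mathscr{A}\neq 0$, the same holds with "normal positive unital" replaced by "normal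 completely positive subunital" for $f$ and $c$. -/

import Mathlib

open CategoryTheory

universe u

/-! ### Kleislian functors -/

section Kleislian

universe v₁ v₂ u₁ u₂

variable {C : Type u₁} [Category.{v₁} C] {D : Type u₂} [Category.{v₂} D]
variable {F : C ⥤ D} {U : D ⥤ C}

theorem comparison_map_comp (adj : F ⊣ U) {X Y Z : C} (f : X ⟶ U.obj (F.obj Y))
    (g : Y ⟶ U.obj (F.obj Z)) :
    F.map (f ≫ U.map (F.map g) ≫ U.map (adj.counit.app (F.obj Z))) ≫ adj.counit.app (F.obj Z) =
      (F.map f ≫ adj.counit.app (F.obj Y)) ≫ F.map g ≫ adj.counit.app (F.obj Z) := by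
  simp

/-- The comparison functor `L : Kl(UF) ⥤ D` of an adjunction `F ⊣ U`: it is `F` on objects and
sends `f : X ⟶ UFY` to the transpose `ε_{FY} ∘ Ff : FX ⟶ FY`. -/
def kleisliComparison (adj : F ⊣ U) : Kleisli adj.toMonad ⥤ D where
  obj X := F.obj X.of
  map {_ Y} f := F.map f.of ≫ adj.counit.app (F.obj Y.of)
  map_id X := adj.left_triangle_components X.of
  map_comp f g := comparison_map_comp adj f.of g.of

/-- `L ∘ V = F`, where `V : C ⥤ Kl(UF)` is the free functor. -/
theorem toKleisli_comp_kleisliComparison (adj : F ⊣ U) :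
    Kleisli.Adjunction.toKleisli adj.toMonad ⋙ kleisliComparison adj = F := by
  refine CategoryTheory.Functor.ext (fun _ => rfl) fun X Y f => ?_
  change F.map (f ≫ adj.unit.app Y) ≫ adj.counit.app (F.obj Y) = 𝟙 _ ≫ F.map f ≫ 𝟙 _
  simp

/-- `U ∘ L = G`, where `G : Kl(UF) ⥤ C` is the forgetful functor. -/
theorem kleisliComparison_comp (adj : F ⊣ U) :
    kleisliComparison adj ⋙ U = Kleisli.Adjunction.fromKleisli adj.toMonad := by
  refine CategoryTheory.Functor.ext (fun _ => rfl) fun X Y f => ?_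
  change U.map (F.map f.of ≫ adj.counit.app (F.obj Y.of)) =
    𝟙 _ ≫ (U.map (F.map f.of) ≫ U.map (adj.counit.app (F.obj Y.of))) ≫ 𝟙 _
  rw [Category.id_comp, Category.comp_id]
  exact U.map_comp _ _

/-- `L` is an isomorphism of categories (not merely an equivalence). -/
def IsCategoryIso (L : C ⥤ D) : Prop :=
  ∃ M : D ⥤ C, L ⋙ M = 𝟭 C ∧ M ⋙ L = 𝟭 D

/-- A functor `F` is Kleislian if it has a right adjoint `U` and the comparison functor
`Kl(UF) ⥤ D` is an isomorphism of categories. -/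
def IsKleislian (F : C ⥤ D) : Prop :=
  ∃ (U : D ⥤ C) (adj : F ⊣ U), IsCategoryIso (kleisliComparison adj)

variable (C D) in
/-- `D` is Kleislian over `C`. -/
def IsKleislianOver : Prop :=
  ∃ F : C ⥤ D, IsKleislian F

end Kleislian

/-! ### Von Neumann algebras and normal maps -/

/-- A C⋆-algebra is a von Neumann algebra if it is ⋆-isomorphic to a von Neumann algebra of
bounded operators on some Hilbert space. -/
def IsVonNeumann (A : Type u) [CStarAlgebra A] : Prop :=
  ∃ (H : Type u) (_ : NormedAddCommGroup H) (_ : InnerProductSpace ℂ H) (_ : CompleteSpace H)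
    (N : VonNeumannAlgebra H), Nonempty (A ≃⋆ₐ[ℂ] N.toStarSubalgebra)

/-- An object of the categories below: a von Neumann algebra (as an abstract C⋆-algebra), with its
C⋆-algebra order, which is determined by the `StarOrderedRing` property. -/
structure VNAlg where
  carrier : Type u
  [cstar : CStarAlgebra carrier]
  [order : PartialOrder carrier]
  [starOrdered : StarOrderedRing carrier]
  isVonNeumann : IsVonNeumann carrier

instance : CoeSort VNAlg.{u} (Type u) := ⟨VNAlg.carrier⟩

attribute [instance] VNAlg.cstar VNAlg.order VNAlg.starOrdered

/-- `f` preserves suprema of upwards directed (nonempty) sets of self-adjoint elements. -/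
def IsNormalMap {A B : VNAlg.{u}} (f : A → B) : Prop :=
  ∀ (D : Set A) (s : A), D.Nonempty → DirectedOn (· ≤ ·) D → (∀ a ∈ D, IsSelfAdjoint a) →
    IsLUB D s → IsLUB (f '' D) (f s)

theorem IsNormalMap.id (A : VNAlg.{u}) : IsNormalMap (fun a : A => a) := by
  intro D s _ _ _ h
  simpa using h

theorem IsNormalMap.comp {A B C : VNAlg.{u}} {f : A → B} {g : B → C} (hg : IsNormalMap g)
    (hf : IsNormalMap f) (hmono : Monotone f)
    (hsa : ∀ a, IsSelfAdjoint a → IsSelfAdjoint (f a)) : IsNormalMap (fun a => g (f a)) := by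
  intro D s hne hdir hD hs
  have h := hg (f '' D) (f s) (hne.image f)
    (by
      rintro _ ⟨a, ha, rfl⟩ _ ⟨b, hb, rfl⟩
      obtain ⟨c, hc, hac, hbc⟩ := hdir a ha b hb
      exact ⟨f c, ⟨c, hc, rfl⟩, hmono hac, hmono hbc⟩)
    (by
      rintro _ ⟨a, ha, rfl⟩
      exact hsa a (hD a ha))
    (hf D s hne hdir hD hs)
  simpa [Set.image_image] using h

/-- Normal unital ⋆-homomorphisms. -/
structure NMIUHom (A B : VNAlg.{u}) extends A →⋆ₐ[ℂ] B where
  normal : IsNormalMap toFun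

/-- Normal positive unital linear maps. -/
structure NPUHom (A B : VNAlg.{u}) extends A →ₚ[ℂ] B where
  map_one : toFun 1 = 1
  normal : IsNormalMap toFun

/-- Normal completely positive subunital linear maps. -/
structure NCPsUHom (A B : VNAlg.{u}) extends CompletelyPositiveMap A B where
  map_one_le : toFun 1 ≤ 1
  normal : IsNormalMap toFun

namespace NMIUHom

theorem monotone {A B : VNAlg.{u}} (f : NMIUHom A B) : Monotone f.toStarAlgHom :=
  fun _ _ h => OrderHomClass.mono f.toStarAlgHom h

@[ext]
theorem ext {A B : VNAlg.{u}} {f g : NMIUHom A B} (h : ∀ a, f.toStarAlgHom a = g.toStarAlgHom a) :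
    f = g := by
  cases f; cases g
  congr 1
  exact StarAlgHom.ext h

noncomputable def id (A : VNAlg.{u}) : NMIUHom A A where
  toStarAlgHom := StarAlgHom.id ℂ A
  normal := IsNormalMap.id A

noncomputable def comp {A B C : VNAlg.{u}} (g : NMIUHom B C) (f : NMIUHom A B) : NMIUHom A C where
  toStarAlgHom := g.toStarAlgHom.comp f.toStarAlgHom
  normal := g.normal.comp f.normal f.monotone fun _ h => h.map f.toStarAlgHom

/-- A normal unital ⋆-homomorphism as a normal positive unital map. -/
noncomputable def toNPU {A B : VNAlg.{u}} (f : NMIUHom A B) : NPUHom A B where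
  toPositiveLinearMap :=
    { toLinearMap := f.toStarAlgHom.toAlgHom.toLinearMap
      monotone' := f.monotone }
  map_one := _root_.map_one f.toStarAlgHom
  normal := f.normal

/-- A normal unital ⋆-homomorphism as a normal completely positive subunital map. -/
noncomputable def toNCPsU {A B : VNAlg.{u}} (f : NMIUHom A B) : NCPsUHom A B where
  toLinearMap := f.toStarAlgHom.toAlgHom.toLinearMap
  map_cstarMatrix_nonneg' k M hM :=
    CompletelyPositiveMapClass.map_cstarMatrix_nonneg' f.toStarAlgHom k M hM
  map_one_le := (_root_.map_one f.toStarAlgHom).le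
  normal := f.normal

end NMIUHom

namespace NPUHom

theorem isSelfAdjoint {A B : VNAlg.{u}} (f : NPUHom A B) (a : A) (h : IsSelfAdjoint a) :
    IsSelfAdjoint (f.toPositiveLinearMap a) :=
  h.map f.toPositiveLinearMap

@[ext]
theorem ext {A B : VNAlg.{u}} {f g : NPUHom A B}
    (h : ∀ a, f.toPositiveLinearMap a = g.toPositiveLinearMap a) : f = g := by
  cases f; cases g
  congr 1
  exact PositiveLinearMap.ext h

noncomputable def id (A : VNAlg.{u}) : NPUHom A A where
  toPositiveLinearMap := PositiveLinearMap.id ℂ A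
  map_one := rfl
  normal := IsNormalMap.id A

noncomputable def comp {A B C : VNAlg.{u}} (g : NPUHom B C) (f : NPUHom A B) : NPUHom A C where
  toPositiveLinearMap := g.toPositiveLinearMap.comp f.toPositiveLinearMap
  map_one := (congrArg g.toFun f.map_one).trans g.map_one
  normal := g.normal.comp f.normal f.monotone' f.isSelfAdjoint

end NPUHom

namespace NCPsUHom

theorem monotone {A B : VNAlg.{u}} (f : NCPsUHom A B) : Monotone f.toCompletelyPositiveMap :=
  fun _ _ h => OrderHomClass.mono f.toCompletelyPositiveMap h

theorem isSelfAdjoint {A B : VNAlg.{u}} (f : NCPsUHom A B) (a : A) (h : IsSelfAdjoint a) :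
    IsSelfAdjoint (f.toCompletelyPositiveMap a) :=
  h.map (PositiveLinearMap.ofClass (R := ℂ) f.toCompletelyPositiveMap)

@[ext]
theorem ext {A B : VNAlg.{u}} {f g : NCPsUHom A B}
    (h : ∀ a, f.toCompletelyPositiveMap a = g.toCompletelyPositiveMap a) : f = g := by
  cases f; cases g
  congr 1
  exact DFunLike.ext _ _ h

noncomputable def id (A : VNAlg.{u}) : NCPsUHom A A where
  toLinearMap := LinearMap.id
  map_cstarMatrix_nonneg' _ _ hM := hM
  map_one_le := le_rfl
  normal := IsNormalMap.id A

noncomputable def comp {A B C : VNAlg.{u}} (g : NCPsUHom B C) (f : NCPsUHom A B) : NCPsUHom A C where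
  toLinearMap := g.toLinearMap.comp f.toLinearMap
  map_cstarMatrix_nonneg' k M hM :=
    g.map_cstarMatrix_nonneg' k _ (f.map_cstarMatrix_nonneg' k M hM)
  map_one_le := (g.monotone f.map_one_le).trans g.map_one_le
  normal := g.normal.comp f.normal f.monotone f.isSelfAdjoint

end NCPsUHom

/-! ### The three categories; they have the same objects -/

/-- Von Neumann algebras with normal unital ⋆-homomorphisms. -/
def WNMIU : Type (u + 1) := VNAlg.{u}

/-- Von Neumann algebras with normal positive unital maps. -/
def WNPU : Type (u + 1) := VNAlg.{u}

/-- Von Neumann algebras with normal completely positive subunital maps. -/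
def WNCPsU : Type (u + 1) := VNAlg.{u}

instance : CoeSort WNMIU.{u} (Type u) := ⟨VNAlg.carrier⟩
instance : CoeSort WNPU.{u} (Type u) := ⟨VNAlg.carrier⟩
instance : CoeSort WNCPsU.{u} (Type u) := ⟨VNAlg.carrier⟩

noncomputable instance : Category.{u} WNMIU.{u} where
  Hom A B := NMIUHom A B
  id A := NMIUHom.id A
  comp f g := NMIUHom.comp g f

noncomputable instance : Category.{u} WNPU.{u} where
  Hom A B := NPUHom A B
  id A := NPUHom.id A
  comp f g := NPUHom.comp g f

noncomputable instance : Category.{u} WNCPsU.{u} where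
  Hom A B := NCPsUHom A B
  id A := NCPsUHom.id A
  comp f g := NCPsUHom.comp g f

/-- The inclusion of `WNMIU` into `WNPU`: the identity on objects. -/
noncomputable def inclNPU : WNMIU.{u} ⥤ WNPU.{u} where
  obj A := A
  map f := NMIUHom.toNPU f

/-- The inclusion of `WNMIU` into `WNCPsU`: the identity on objects. -/
noncomputable def inclNCPsU : WNMIU.{u} ⥤ WNCPsU.{u} where
  obj A := A
  map f := NMIUHom.toNCPsU f

/-! # Kleislian adjunctions between categories of von Neumann algebras -/

/-! ### Opposites of right adjoints that are bijective on objects -/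

section Kleislian

universe v₁ v₂ u₁ u₂

variable {C : Type u₁} [Category.{v₁} C] {D : Type u₂} [Category.{v₂} D]

/-! The comparison functor of any adjunction is fully faithful, and on objects it is the left
adjoint. The opposite of an inclusion is the identity on objects, so both Kleislian statements
reduce to a left adjoint of the inclusion, that is, to a universal arrow `A → F` for every `A`.

Universal arrows come from a solution set. A map into `B` factors through the von Neumann algebra
generated by its image and the scalars. That algebra is small: a ring generated by the given set,
its adjoints and a countable dense set of scalars is strongly dense in it
(`exists_norm_sub_lt_of_mem_bicommutant`), and an operator is determined by the traces of its strong
neighbourhoods on this ring (`mk_bicommutant_le`). So, up to isomorphism, the targets form a set. On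
the Hilbert sum of their representations, let `F` be generated by the block-diagonal image of `A`;
compressing to the summands gives normal ⋆-homomorphisms to all targets
(`IsReflectedClass.exists_product`).

Uniqueness asks that normal ⋆-homomorphisms agreeing on generators be equal. Normality is an order
condition, whereas density is strong, so a bridge is needed: by Vigier's theorem directed suprema
are strong limits, and two maximality arguments show that a normal vector functional is, below some
positive element that it does not annihilate, dominated by a vector functional of a faithful
representation (`exists_re_inner_le`). This gives enough strongly continuous matrix coefficients
(`IsNormalRep.eq_of_dense`).

Both kinds of maps are treated at once through `IsReflectedClass`: beyond positivity and
subunitality, it suffices that membership can be tested after a jointly injective family of normal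
⋆-homomorphisms. -/

/-- A fully faithful functor that is bijective on objects is an isomorphism of categories. -/
theorem isCategoryIso_of_fullyFaithful {L : C ⥤ D} (hL : L.FullyFaithful) (g : D → C)
    (h₁ : ∀ X, g (L.obj X) = X) (h₂ : ∀ Y, L.obj (g Y) = Y) : IsCategoryIso L := by
  let M : D ⥤ C :=
    { obj := g
      map := fun {X Y} f => hL.preimage (eqToHom (h₂ X) ≫ f ≫ eqToHom (h₂ Y).symm)
      map_id := fun X => hL.map_injective (by simp)
      map_comp := fun f f' => hL.map_injective (by simp) }
  refine ⟨M, ?_, ?_⟩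
  · refine CategoryTheory.Functor.ext h₁ fun X Y f => hL.map_injective ?_
    simp [M, eqToHom_map]
  · refine CategoryTheory.Functor.ext h₂ fun X Y f => ?_
    simp [M]

/-- The comparison functor from the Kleisli category is fully faithful. -/
def kleisliComparisonFullyFaithful {F : C ⥤ D} {U : D ⥤ C} (adj : F ⊣ U) :
    (kleisliComparison adj).FullyFaithful where
  preimage {X Y} f := ⟨adj.homEquiv X.of (F.obj Y.of) f⟩
  map_preimage {X Y} f :=
    (adj.homEquiv_counit _ _ _).symm.trans ((adj.homEquiv X.of (F.obj Y.of)).symm_apply_apply f)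
  preimage_map {X Y} f := Kleisli.Hom.ext <|
    (congrArg (adj.homEquiv X.of (F.obj Y.of)) (adj.homEquiv_counit _ _ _).symm).trans
      ((adj.homEquiv X.of (F.obj Y.of)).apply_symm_apply f.of)

/-- If a functor that is bijective on objects has a left adjoint, its opposite is Kleislian. -/
theorem isKleislian_op_of_isRightAdjoint (U : C ⥤ D) [U.IsRightAdjoint] (g : D → C)
    (h₁ : ∀ X, g (U.obj X) = X) (h₂ : ∀ Y, U.obj (g Y) = Y) : IsKleislian U.op := by
  refine ⟨U.leftAdjoint.op, (Adjunction.ofIsRightAdjoint U).op,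
    isCategoryIso_of_fullyFaithful (kleisliComparisonFullyFaithful _)
      (fun Y => Kleisli.mk _ (Opposite.op (g Y.unop))) (fun X => ?_) fun Y => ?_⟩
  · exact congrArg (fun Z => Kleisli.mk _ (Opposite.op Z)) (h₁ X.of.unop)
  · change Opposite.op (U.obj (g Y.unop)) = Y
    rw [h₂]

/-- A functor has a left adjoint as soon as every object has a universal arrow to it. -/
theorem isRightAdjoint_of_universal_arrows (U : C ⥤ D)
    (h : ∀ A : D, ∃ (F : C) (η : A ⟶ U.obj F), ∀ (B : C) (f : A ⟶ U.obj B),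
      ∃! k : F ⟶ B, η ≫ U.map k = f) : U.IsRightAdjoint := by
  have : ∀ A : D, Limits.HasInitial (StructuredArrow A U) := by
    intro A
    obtain ⟨F, η, hη⟩ := h A
    have : ∀ X : StructuredArrow A U, Nonempty (Unique (StructuredArrow.mk η ⟶ X)) := by
      intro X
      obtain ⟨k, hk, huniq⟩ := hη X.right X.hom
      exact ⟨{ default := StructuredArrow.homMk k hk
               uniq := fun m => by
                ext
                exact huniq m.right (StructuredArrow.w m) }⟩
    have := fun X => Classical.choice (this X)
    exact Limits.hasInitial_of_unique (StructuredArrow.mk η)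
  exact isRightAdjointOfStructuredArrowInitials U

end Kleislian

/-! ### Positivity detected by families of ⋆-homomorphisms -/

open scoped CStarAlgebra in
/-- A jointly injective family of ⋆-homomorphisms between C⋆-algebras reflects positivity. -/
theorem nonneg_of_forall_map_nonneg {ι A : Type*} {B : ι → Type*} [NonUnitalCStarAlgebra A]
    [PartialOrder A] [StarOrderedRing A] [∀ i, NonUnitalCStarAlgebra (B i)]
    [∀ i, PartialOrder (B i)] [∀ i, StarOrderedRing (B i)] (h : ∀ i, A →⋆ₙₐ[ℂ] B i)
    (hinj : ∀ a, (∀ i, h i a = 0) → a = 0) {a : A} (ha : ∀ i, 0 ≤ h i a) : 0 ≤ a := by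
  have hsa : IsSelfAdjoint a := by
    refine sub_eq_zero.mp (hinj _ fun i => ?_)
    rw [map_sub, map_star, (IsSelfAdjoint.of_nonneg (ha i)).star_eq, sub_self]
  have hneg : IsSelfAdjoint a⁻ := IsSelfAdjoint.of_nonneg (CFC.negPart_nonneg a)
  -- Each image of `a⁻ * a * a⁻` is a conjugate of a positive element, hence positive. As the
  -- negative of a positive cube it is also negative, so every image of the cube vanishes.
  have key : a⁻ * a * a⁻ = -(a⁻ * a⁻ * a⁻) := by
    conv_lhs => enter [1, 2]; rw [← CFC.posPart_sub_negPart a hsa]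
    rw [mul_sub, CFC.negPart_mul_posPart, zero_sub, neg_mul]
  have hcube : 0 ≤ a⁻ * a⁻ * a⁻ := by
    simpa [hneg.star_eq] using star_left_conjugate_nonneg (CFC.negPart_nonneg a) (a⁻)
  have hz : a⁻ * a⁻ * a⁻ = 0 := by
    refine hinj _ fun i => le_antisymm ?_ (map_nonneg (h i) hcube)
    have h1 := star_left_conjugate_nonneg (ha i) (h i (a⁻))
    rw [← map_star, hneg.star_eq, ← map_mul, ← map_mul, key, map_neg] at h1
    exact neg_nonneg.mp h1
  have h4 : (a⁻ * a⁻) * (a⁻ * a⁻) = 0 := by rw [← mul_assoc, hz, zero_mul]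
  have h2 : a⁻ * a⁻ = 0 := by
    refine CStarRing.star_mul_self_eq_zero_iff _ |>.mp ?_
    rwa [star_mul, hneg.star_eq]
  have h0 : a⁻ = 0 := by
    refine CStarRing.star_mul_self_eq_zero_iff _ |>.mp ?_
    rwa [hneg.star_eq]
  exact (CFC.negPart_eq_zero_iff a hsa).mp h0

namespace VNAlg

theorem nonneg_of_forall_map_nonneg {ι : Type*} {B : VNAlg.{u}} {C : ι → VNAlg.{u}}
    (h : ∀ i, NMIUHom B (C i)) (hinj : ∀ b, (∀ i, (h i).toStarAlgHom b = 0) → b = 0) {b : B}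
    (hb : ∀ i, 0 ≤ (h i).toStarAlgHom b) : 0 ≤ b :=
  _root_.nonneg_of_forall_map_nonneg (fun i => ((h i).toStarAlgHom : B →⋆ₙₐ[ℂ] C i)) hinj hb

theorem le_of_forall_map_le {ι : Type*} {B : VNAlg.{u}} {C : ι → VNAlg.{u}}
    (h : ∀ i, NMIUHom B (C i)) (hinj : ∀ b, (∀ i, (h i).toStarAlgHom b = 0) → b = 0) {a b : B}
    (hab : ∀ i, (h i).toStarAlgHom a ≤ (h i).toStarAlgHom b) : a ≤ b := by
  rw [← sub_nonneg]
  refine nonneg_of_forall_map_nonneg h hinj fun i => ?_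
  rw [map_sub, sub_nonneg]
  exact hab i

/-- Entrywise application to matrices keeps the family jointly injective, so complete positivity is
reflected like positivity. -/
theorem matrix_nonneg_of_forall_map_nonneg {ι : Type*} {B : VNAlg.{u}} {C : ι → VNAlg.{u}}
    (h : ∀ i, NMIUHom B (C i)) (hinj : ∀ b, (∀ i, (h i).toStarAlgHom b = 0) → b = 0) {k : ℕ}
    {M : CStarMatrix (Fin k) (Fin k) B} (hM : ∀ i, 0 ≤ M.map (h i).toStarAlgHom) : 0 ≤ M := by
  refine _root_.nonneg_of_forall_map_nonneg
    (fun i => CStarMatrix.mapₙₐ (n := Fin k) ((h i).toStarAlgHom : B →⋆ₙₐ[ℂ] C i))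
    (fun N hN => ?_) hM
  ext p q
  exact hinj _ fun i => congrFun (congrFun (hN i) p) q

/-- Normality is detected by jointly injective families of normal ⋆-homomorphisms. -/
theorem isNormalMap_of_forall {ι : Type*} {A B : VNAlg.{u}} {C : ι → VNAlg.{u}} {f : A → B}
    (hf : Monotone f) (h : ∀ i, NMIUHom B (C i))
    (hinj : ∀ b, (∀ i, (h i).toStarAlgHom b = 0) → b = 0)
    (hn : ∀ i, IsNormalMap fun a => (h i).toStarAlgHom (f a)) : IsNormalMap f := by
  intro D s hne hdir hsa hs
  refine ⟨?_, fun t ht => le_of_forall_map_le h hinj fun i => ?_⟩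
  · rintro _ ⟨a, ha, rfl⟩
    exact hf (hs.1 ha)
  · refine (hn i D s hne hdir hsa hs).2 ?_
    rintro _ ⟨a, ha, rfl⟩
    exact (h i).monotone (ht ⟨a, ha, rfl⟩)

end VNAlg

/-! ### The two classes of maps -/

/-- The linear maps underlying the morphisms of `WNPU`. -/
structure IsNPU {A B : VNAlg.{u}} (f : A →ₗ[ℂ] B) : Prop where
  nonneg : ∀ a, 0 ≤ a → 0 ≤ f a
  map_one : f 1 = 1
  normal : IsNormalMap f

/-- The linear maps underlying the morphisms of `WNCPsU`. -/
structure IsNCPsU {A B : VNAlg.{u}} (f : A →ₗ[ℂ] B) : Prop where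
  nonneg : ∀ (k : ℕ) (M : CStarMatrix (Fin k) (Fin k) A), 0 ≤ M → 0 ≤ M.map f
  map_one_le : f 1 ≤ 1
  normal : IsNormalMap f

/-- The underlying linear map of a normal unital ⋆-homomorphism. -/
def NMIUHom.toLin {A B : VNAlg.{u}} (h : NMIUHom A B) : A →ₗ[ℂ] B :=
  h.toStarAlgHom.toAlgHom.toLinearMap

/-- A class of positive subunital maps between von Neumann algebras that is detected by jointly
injective families of normal ⋆-homomorphisms. -/
structure IsReflectedClass (P : ∀ {A B : VNAlg.{u}}, (A →ₗ[ℂ] B) → Prop) : Prop where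
  nonneg : ∀ {A B : VNAlg.{u}} {f : A →ₗ[ℂ] B}, P f → ∀ a, 0 ≤ a → 0 ≤ f a
  map_one_le : ∀ {A B : VNAlg.{u}} {f : A →ₗ[ℂ] B}, P f → f 1 ≤ 1
  reflect : ∀ {ι : Type u} {A B : VNAlg.{u}} {C : ι → VNAlg.{u}} {f : A →ₗ[ℂ] B}
    (h : ∀ i, NMIUHom B (C i)), (∀ b, (∀ i, (h i).toStarAlgHom b = 0) → b = 0) →
    (∀ i, P ((h i).toLin ∘ₗ f)) → P f

theorem IsNPU.isReflectedClass : IsReflectedClass.{u} @IsNPU where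
  nonneg hf := hf.nonneg
  map_one_le hf := hf.map_one.le
  reflect {ι A B C f} h hinj hf := by
    have hnn : ∀ a, 0 ≤ a → 0 ≤ f a := fun a ha =>
      VNAlg.nonneg_of_forall_map_nonneg h hinj fun i => (hf i).nonneg a ha
    refine ⟨hnn, sub_eq_zero.mp (hinj _ fun i => ?_),
      VNAlg.isNormalMap_of_forall (PositiveLinearMap.mk₀ f hnn).monotone' h hinj
        fun i => (hf i).normal⟩
    rw [map_sub, _root_.map_one (h i).toStarAlgHom, sub_eq_zero]
    exact (hf i).map_one

/-- The morphism of `WNPU` with a given underlying linear map. -/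
noncomputable def IsNPU.toHom {A B : VNAlg.{u}} {f : A →ₗ[ℂ] B} (hf : IsNPU f) : NPUHom A B where
  toPositiveLinearMap := PositiveLinearMap.mk₀ f hf.nonneg
  map_one := hf.map_one
  normal := hf.normal

/-- The morphism of `WNCPsU` with a given underlying linear map. -/
def IsNCPsU.toHom {A B : VNAlg.{u}} {f : A →ₗ[ℂ] B} (hf : IsNCPsU f) : NCPsUHom A B where
  toLinearMap := f
  map_cstarMatrix_nonneg' := hf.nonneg
  map_one_le := hf.map_one_le
  normal := hf.normal

theorem IsNCPsU.map_nonneg {A B : VNAlg.{u}} {f : A →ₗ[ℂ] B} (hf : IsNCPsU f) (a : A)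
    (ha : 0 ≤ a) : 0 ≤ f a := by
  have h := hf.toHom.monotone ha
  rwa [_root_.map_zero] at h

theorem NPUHom.isNPU {A B : VNAlg.{u}} (f : NPUHom A B) : IsNPU f.toLinearMap where
  nonneg _ ha := map_nonneg f.toPositiveLinearMap ha
  map_one := f.map_one
  normal := f.normal

theorem NCPsUHom.isNCPsU {A B : VNAlg.{u}} (f : NCPsUHom A B) : IsNCPsU f.toLinearMap where
  nonneg := f.map_cstarMatrix_nonneg'
  map_one_le := f.map_one_le
  normal := f.normal

theorem IsNCPsU.isReflectedClass : IsReflectedClass.{u} @IsNCPsU where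
  nonneg hf := hf.map_nonneg
  map_one_le hf := hf.map_one_le
  reflect {ι A B C f} h hinj hf := by
    have hcp : ∀ (k : ℕ) (M : CStarMatrix (Fin k) (Fin k) A), 0 ≤ M → 0 ≤ M.map f :=
      fun k M hM => VNAlg.matrix_nonneg_of_forall_map_nonneg h hinj
        fun i => (hf i).nonneg k M hM
    have hnn : ∀ a, 0 ≤ a → 0 ≤ f a := fun a ha =>
      VNAlg.nonneg_of_forall_map_nonneg h hinj fun i => (hf i).map_nonneg a ha
    refine ⟨hcp, VNAlg.le_of_forall_map_le h hinj fun i => ?_,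
      VNAlg.isNormalMap_of_forall (PositiveLinearMap.mk₀ f hnn).monotone' h hinj
        fun i => (hf i).normal⟩
    rw [_root_.map_one (h i).toStarAlgHom]
    exact (hf i).map_one_le

/-! ### The double commutant theorem -/

section DoubleCommutant

open scoped InnerProductSpace

variable {H : Type*} [NormedAddCommGroup H] [InnerProductSpace ℂ H]
variable {ι : Type*}

/-- The diagonal action of an operator on a finite power of a Hilbert space. -/
noncomputable def amplify (T : H →L[ℂ] H) : PiLp 2 (fun _ : ι => H) →L[ℂ] PiLp 2 (fun _ : ι => H) :=
  (PiLp.continuousLinearEquiv 2 ℂ fun _ : ι => H).symm.toContinuousLinearMap ∘L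
    ContinuousLinearMap.pi fun i => T ∘L PiLp.proj 2 (fun _ : ι => H) i

@[simp]
theorem amplify_apply (T : H →L[ℂ] H) (y : PiLp 2 (fun _ : ι => H)) (i : ι) :
    amplify T y i = T (y i) := rfl

variable [Fintype ι]

/-- An operator in the bicommutant commutes, after amplification, with every operator that
commutes with all amplifications of the given operators. -/
theorem amplify_commute_of_mem_bicommutant {S : Set (H →L[ℂ] H)} {T : H →L[ℂ] H}
    (hT : T ∈ S.centralizer.centralizer)
    {P : PiLp 2 (fun _ : ι => H) →L[ℂ] PiLp 2 (fun _ : ι => H)}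
    (hP : ∀ s ∈ S, ∀ y, P (amplify s y) = amplify s (P y)) (y : PiLp 2 fun _ : ι => H) :
    P (amplify T y) = amplify T (P y) := by
  classical
  let e : ι → H →L[ℂ] PiLp 2 (fun _ : ι => H) := fun j =>
    (PiLp.continuousLinearEquiv 2 ℂ fun _ : ι => H).symm.toContinuousLinearMap ∘L
      ContinuousLinearMap.single ℂ (fun _ : ι => H) j
  have he : ∀ (U : H →L[ℂ] H) (j : ι) (v : H), amplify U (e j v) = e j (U v) := by
    intro U j v
    ext i
    by_cases hij : i = j
    · subst hij
      simp [e]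
    · simp [e, hij]
  have hsum : ∀ y : PiLp 2 (fun _ : ι => H), y = ∑ j, e j (y j) := by
    intro y
    ext i
    simp [e, Finset.sum_apply, Pi.single_apply]
  have hc : ∀ (i j : ι) (v : H), P (e j (T v)) i = T (P (e j v) i) := by
    intro i j v
    -- The matrix entries of `P` lie in the commutant of `S`, so `T` commutes with each of them.
    have hmem : PiLp.proj 2 (fun _ : ι => H) i ∘L P ∘L e j ∈ S.centralizer := by
      intro s hs
      ext v
      have := congrArg (fun z : PiLp 2 (fun _ : ι => H) => z i) (hP s hs (e j v))
      simp only [he, amplify_apply] at this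
      exact this.symm
    exact DFunLike.congr_fun (hT _ hmem) v
  ext i
  rw [amplify_apply]
  conv_lhs => rw [hsum y]
  conv_rhs => rw [hsum y]
  simp only [map_sum, he, WithLp.ofLp_sum, Finset.sum_apply, hc]

variable [CompleteSpace H]

theorem inner_amplify_left (T : H →L[ℂ] H) (y z : PiLp 2 (fun _ : ι => H)) :
    ⟪amplify T y, z⟫_ℂ = ⟪y, amplify (star T) z⟫_ℂ := by
  simp [PiLp.inner_apply, ContinuousLinearMap.star_eq_adjoint,
    ContinuousLinearMap.adjoint_inner_right]

/-- The projection onto a closed subspace commutes with operators leaving the subspace invariant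
together with their adjoints. -/
theorem starProjection_amplify {M : Submodule ℂ (PiLp 2 fun _ : ι => H)}
    [M.HasOrthogonalProjection] {s : H →L[ℂ] H} (h : ∀ y ∈ M, amplify s y ∈ M)
    (h' : ∀ y ∈ M, amplify (star s) y ∈ M) (y : PiLp 2 fun _ : ι => H) :
    M.starProjection (amplify s y) = amplify s (M.starProjection y) := by
  refine Submodule.eq_starProjection_of_mem_orthogonal
    (h _ (Submodule.starProjection_apply_mem M y)) ?_
  rw [← map_sub, Submodule.mem_orthogonal']
  intro m hm
  rw [inner_amplify_left]
  exact Submodule.inner_left_of_mem_orthogonal (h' m hm)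
    (Submodule.sub_starProjection_mem_orthogonal y)

/-- **Von Neumann's double commutant theorem**: a self-adjoint ring of operators, whose closure
contains the scalars, approximates every element of its bicommutant on finitely many vectors. -/
theorem exists_norm_sub_lt_of_mem_bicommutant {S : Subring (H →L[ℂ] H)}
    (hstar : ∀ s ∈ S, star s ∈ S) (hscal : ∀ z : ℂ, z • (1 : H →L[ℂ] H) ∈ closure (S : Set (H →L[ℂ] H)))
    {T : H →L[ℂ] H} (hT : T ∈ (S : Set (H →L[ℂ] H)).centralizer.centralizer) (ξ : ι → H) {ε : ℝ}
    (hε : 0 < ε) : ∃ s ∈ S, ∀ i, ‖s (ξ i) - T (ξ i)‖ < ε := by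
  let x : PiLp 2 (fun _ : ι => H) := WithLp.toLp 2 ξ
  let V : (H →L[ℂ] H) → PiLp 2 (fun _ : ι => H) := fun s => amplify s x
  have hVc : Continuous V :=
    (PiLp.continuousLinearEquiv 2 ℂ fun _ : ι => H).symm.continuous.comp
      (continuous_pi fun i => (ContinuousLinearMap.apply ℂ H (ξ i)).continuous)
  have hVadd : ∀ s t, V (s + t) = V s + V t := fun s t => by ext i; rfl
  have hVmul : ∀ s t, amplify s (V t) = V (s * t) := fun s t => rfl
  have hVzero : V 0 = 0 := by ext i; rfl
  -- `S` is only a ring, so that it can be kept small; norm approximation of the scalars makes the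
  -- closed orbit of `x` a complex subspace.
  have hsmul : ∀ (z : ℂ) (s : H →L[ℂ] H), s ∈ S → z • V s ∈ closure (V '' S) := by
    intro z s hs
    have h1 : z • V s = V ((z • (1 : H →L[ℂ] H)) * s) := by ext i; rfl
    rw [h1]
    refine map_mem_closure (f := fun w : H →L[ℂ] H => V (w * s))
      (hVc.comp (continuous_mul_const s)) (hscal z) fun w hw => ⟨w * s, S.mul_mem hw hs, rfl⟩
  let M : Submodule ℂ (PiLp 2 fun _ : ι => H) :=
    { carrier := closure (V '' S)
      zero_mem' := subset_closure ⟨0, S.zero_mem, hVzero⟩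
      add_mem' := fun ha hb => map_mem_closure₂ continuous_add ha hb (by
        rintro _ ⟨s, hs, rfl⟩ _ ⟨t, ht, rfl⟩
        exact ⟨s + t, S.add_mem hs ht, hVadd s t⟩)
      smul_mem' := fun z y hy => by
        have := map_mem_closure (t := closure (V '' S)) (continuous_const_smul z) hy (by
          rintro _ ⟨s, hs, rfl⟩
          exact hsmul z s hs)
        rwa [closure_closure] at this }
  have hMclosed : IsClosed (M : Set (PiLp 2 fun _ : ι => H)) := isClosed_closure
  have : CompleteSpace M := hMclosed.completeSpace_coe
  have hinv : ∀ s ∈ S, ∀ y ∈ M, amplify s y ∈ M := fun s hs y hy =>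
    map_mem_closure (amplify s).continuous hy (by
      rintro _ ⟨t, ht, rfl⟩
      exact ⟨s * t, S.mul_mem hs ht, rfl⟩)
  have hx : x ∈ M := subset_closure ⟨1, S.one_mem, by ext i; rfl⟩
  -- The projection onto `M` commutes with the amplified `S`, hence with the amplified `T`, and it
  -- fixes `x`.
  have hmem : amplify T x ∈ M := by
    have h := amplify_commute_of_mem_bicommutant hT (P := M.starProjection)
      (fun s hs y => starProjection_amplify (hinv s hs) (hinv _ (hstar s hs)) y) x
    rw [Submodule.starProjection_eq_self_iff.mpr hx] at h
    exact Submodule.starProjection_eq_self_iff.mp h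
  obtain ⟨_, ⟨s, hs, rfl⟩, hlt⟩ := Metric.mem_closure_iff.mp hmem ε hε
  refine ⟨s, hs, fun i => lt_of_le_of_lt ?_ hlt⟩
  rw [dist_comm, dist_eq_norm]
  exact PiLp.norm_apply_le (V s - amplify T x) i

/-- The cardinality of the bicommutant is bounded by that of the double power set. -/
theorem mk_bicommutant_le {H : Type u} [NormedAddCommGroup H] [InnerProductSpace ℂ H]
    [CompleteSpace H] {S : Subring (H →L[ℂ] H)}
    (hstar : ∀ s ∈ S, star s ∈ S) (hscal : ∀ z : ℂ, z • (1 : H →L[ℂ] H) ∈ closure (S : Set (H →L[ℂ] H))) :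
    Cardinal.mk (S : Set (H →L[ℂ] H)).centralizer.centralizer ≤ Cardinal.mk (Set (Set S)) := by
  -- `T` is encoded by the subsets of `S` containing the trace of a one-vector strong neighbourhood
  -- of `T`.
  let Φ : (S : Set (H →L[ℂ] H)).centralizer.centralizer → Set (Set S) := fun T =>
    {U | ∃ (ξ : H) (ε : ℝ), 0 < ε ∧ ∀ s : S, ‖(s : H →L[ℂ] H) ξ - T.1 ξ‖ < ε → s ∈ U}
  refine Cardinal.mk_le_of_injective (f := Φ) fun T T' h => ?_
  by_contra hne
  have : ∃ ξ, T.1 ξ ≠ T'.1 ξ := by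
    by_contra! hall
    exact hne (Subtype.ext (ContinuousLinearMap.ext hall))
  obtain ⟨ξ, hξ⟩ := this
  have hpos : 0 < ‖T.1 ξ - T'.1 ξ‖ / 2 := half_pos (norm_pos_iff.mpr (sub_ne_zero.mpr hξ))
  have hU : {s : S | ‖(s : H →L[ℂ] H) ξ - T.1 ξ‖ < ‖T.1 ξ - T'.1 ξ‖ / 2} ∈ Φ T :=
    ⟨ξ, _, hpos, fun s hs => hs⟩
  rw [h] at hU
  obtain ⟨η, ε, hε, hη⟩ := hU
  -- Closeness at `η` puts `s` into the neighbourhood of `T`, while closeness at `ξ` keeps it near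
  -- `T'`; the two balls at `ξ` are disjoint.
  obtain ⟨s, hs, hlt⟩ := exists_norm_sub_lt_of_mem_bicommutant hstar hscal T'.2 ![ξ, η]
    (lt_min hε hpos)
  have h0 := (hlt 0).trans_le (min_le_right _ _)
  have h1 := hη ⟨s, hs⟩ ((hlt 1).trans_le (min_le_left _ _))
  simp only [Matrix.cons_val_zero] at h0
  have h2 : ‖T.1 ξ - T'.1 ξ‖ ≤ ‖s ξ - T'.1 ξ‖ + ‖s ξ - T.1 ξ‖ := by
    rw [← norm_neg (s ξ - T.1 ξ)]
    refine (le_of_eq ?_).trans (norm_add_le _ _)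
    congr 1
    abel
  have h3 : ‖s ξ - T.1 ξ‖ < ‖T.1 ξ - T'.1 ξ‖ / 2 := h1
  linarith

end DoubleCommutant

/-! ### The von Neumann algebra generated by a set of operators -/

namespace VonNeumannAlgebra

variable {H : Type u} [NormedAddCommGroup H] [InnerProductSpace ℂ H] [CompleteSpace H]

/-- The von Neumann algebra generated by a set of operators. -/
noncomputable def generatedBy (X : Set (H →L[ℂ] H)) : VonNeumannAlgebra H where
  toStarSubalgebra := StarSubalgebra.centralizer ℂ (StarSubalgebra.centralizer ℂ X : Set (H →L[ℂ] H))
  centralizer_centralizer' := by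
    change Set.centralizer (Set.centralizer (StarSubalgebra.centralizer ℂ
      (StarSubalgebra.centralizer ℂ X : Set (H →L[ℂ] H)) : Set (H →L[ℂ] H))) =
        (StarSubalgebra.centralizer ℂ
          (StarSubalgebra.centralizer ℂ X : Set (H →L[ℂ] H)) : Set (H →L[ℂ] H))
    rw [StarSubalgebra.coe_centralizer_centralizer, Set.centralizer_centralizer_centralizer]

theorem coe_generatedBy (X : Set (H →L[ℂ] H)) :
    (generatedBy X : Set (H →L[ℂ] H)) = (X ∪ star X).centralizer.centralizer :=
  StarSubalgebra.coe_centralizer_centralizer ℂ X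

theorem subset_generatedBy (X : Set (H →L[ℂ] H)) : X ⊆ generatedBy X := by
  rw [coe_generatedBy]
  exact Set.subset_union_left.trans Set.subset_centralizer_centralizer

theorem generatedBy_le {X : Set (H →L[ℂ] H)} {M : VonNeumannAlgebra H} (h : X ⊆ M) :
    generatedBy X ≤ M := by
  have h1 : X ∪ star X ⊆ M := Set.union_subset h fun x hx => by
    have : star (star x) ∈ M := star_mem (h hx)
    rwa [star_star] at this
  have h2 := Set.centralizer_subset (Set.centralizer_subset h1)
  rw [← coe_generatedBy, centralizer_centralizer] at h2
  exact h2

theorem isLeast_generatedBy {X : Set (H →L[ℂ] H)} {B : VonNeumannAlgebra H} (h : X ⊆ B) :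
    IsLeast {M : VonNeumannAlgebra H | M ≤ B ∧ X ⊆ M} (generatedBy X) :=
  ⟨⟨generatedBy_le h, subset_generatedBy X⟩, fun _ hM => generatedBy_le hM.2⟩

/-- Elements of the generated von Neumann algebra are approximated, on finitely many vectors, by
elements of the generated ⋆-algebra. -/
theorem exists_adjoin_norm_sub_lt {X : Set (H →L[ℂ] H)} {T : H →L[ℂ] H} (hT : T ∈ generatedBy X)
    {ι : Type*} [Fintype ι] (ξ : ι → H) {ε : ℝ} (hε : 0 < ε) :
    ∃ s ∈ StarAlgebra.adjoin ℂ X, ∀ i, ‖s (ξ i) - T (ξ i)‖ < ε := by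
  refine exists_norm_sub_lt_of_mem_bicommutant (S := (StarAlgebra.adjoin ℂ X).toSubalgebra.toSubring)
    (fun s hs => (StarAlgebra.adjoin ℂ X).star_mem' hs)
    (fun z => subset_closure ((StarAlgebra.adjoin ℂ X).smul_mem (one_mem _) z)) ?_ ξ hε
  have h : T ∈ (generatedBy X : Set (H →L[ℂ] H)) := hT
  rw [coe_generatedBy] at h
  refine Set.centralizer_subset (Set.centralizer_subset (Set.union_subset
    (StarAlgebra.subset_adjoin ℂ X) fun x hx => ?_)) h
  exact StarAlgebra.star_subset_adjoin ℂ X hx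

/-- The cardinality of the von Neumann algebra generated by an infinite set. -/
theorem mk_generatedBy_le {X : Set (H →L[ℂ] H)} (hX : X.Infinite) :
    Cardinal.mk (generatedBy X : Set (H →L[ℂ] H)) ≤ Cardinal.mk (Set (Set X)) := by
  obtain ⟨D, hDc, hDd⟩ := TopologicalSpace.exists_countable_dense ℂ
  -- Only countably many scalars are adjoined and the ring is generated over `ℤ`, so its cardinality
  -- stays at most `#X`, even when `X` is smaller than the continuum.
  let Z₀ : Set (H →L[ℂ] H) := X ∪ (fun z : ℂ => z • (1 : H →L[ℂ] H)) '' D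
  let Z : Set (H →L[ℂ] H) := Z₀ ∪ star Z₀
  have hX' : Cardinal.aleph0 ≤ Cardinal.mk X := Cardinal.aleph0_le_mk_iff.mpr hX.to_subtype
  have hZ₀ : Cardinal.mk Z₀ ≤ Cardinal.mk X :=
    (Cardinal.mk_union_le _ _).trans (Cardinal.add_le_of_le hX' le_rfl
      ((hDc.image _).le_aleph0.trans hX'))
  have hZ : Cardinal.mk Z ≤ Cardinal.mk X := by
    refine (Cardinal.mk_union_le _ _).trans (Cardinal.add_le_of_le hX' hZ₀ (le_trans ?_ hZ₀))
    rw [← Set.image_star]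
    exact Cardinal.mk_image_le
  have hZs : ∀ z ∈ Z, star z ∈ Z := by
    rintro z (hz | hz)
    · exact Or.inr (by simpa using hz)
    · exact Or.inl hz
  let S := Algebra.adjoin ℤ Z
  have hS : Cardinal.mk S ≤ Cardinal.mk X := by
    have h := Algebra.lift_cardinalMk_adjoin_le ℤ Z
    simp only [Cardinal.mk_int, Cardinal.lift_aleph0, Cardinal.lift_uzero] at h
    exact h.trans (by simp [hX', hZ])
  have hstar : ∀ s ∈ S.toSubring, star s ∈ S.toSubring := by
    intro s hs
    refine Algebra.adjoin_induction (p := fun s _ => star s ∈ S) (fun z hz => ?_) (fun n => ?_)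
      (fun a b _ _ ha hb => ?_) (fun a b _ _ ha hb => ?_) hs
    · exact Algebra.subset_adjoin (hZs z hz)
    · simp
    · rw [star_add]
      exact S.add_mem ha hb
    · rw [star_mul]
      exact S.mul_mem hb ha
  have hscal : ∀ z : ℂ, z • (1 : H →L[ℂ] H) ∈ closure (S.toSubring : Set (H →L[ℂ] H)) := by
    intro z
    refine map_mem_closure (f := fun z : ℂ => z • (1 : H →L[ℂ] H)) (by fun_prop) (hDd z) ?_
    intro d hd
    exact Algebra.subset_adjoin (Or.inl (Or.inr ⟨d, hd, rfl⟩))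
  have hle : (generatedBy X : Set (H →L[ℂ] H)) ⊆
      (S.toSubring : Set (H →L[ℂ] H)).centralizer.centralizer := by
    rw [coe_generatedBy]
    refine Set.centralizer_subset (Set.centralizer_subset fun x hx => Algebra.subset_adjoin ?_)
    exact hx.imp (fun h => Or.inl h) (fun h => Or.inl h)
  refine (Cardinal.mk_le_mk_of_subset hle).trans ((mk_bicommutant_le hstar hscal).trans ?_)
  simp only [Cardinal.mk_set]
  exact Cardinal.power_le_power_left two_ne_zero
    (Cardinal.power_le_power_left two_ne_zero hS)

end VonNeumannAlgebra

/-! ### Faithful normal representations -/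

section Representation

open Filter Topology
open scoped InnerProductSpace

variable {A B : VNAlg.{u}}
variable {H : Type*} [NormedAddCommGroup H] [InnerProductSpace ℂ H] [CompleteSpace H]
variable {K : Type*} [NormedAddCommGroup K] [InnerProductSpace ℂ K] [CompleteSpace K]

theorem isDirectedOrder_coe {α : Type*} [Preorder α] {D : Set α} (hdir : DirectedOn (· ≤ ·) D) :
    IsDirectedOrder D :=
  directedOn_univ_iff.mp fun a _ b _ => by
    obtain ⟨c, hc, hac, hbc⟩ := hdir a a.2 b b.2
    exact ⟨⟨c, hc⟩, trivial, hac, hbc⟩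

theorem isSelfAdjoint_of_le {A : Type*} [NonUnitalRing A] [StarRing A] [PartialOrder A]
    [StarOrderedRing A] {a b : A} (ha : IsSelfAdjoint a) (hab : a ≤ b) : IsSelfAdjoint b := by
  have := (IsSelfAdjoint.of_nonneg (sub_nonneg.mpr hab)).add ha
  rwa [sub_add_cancel] at this

/-- Conjugate `a ≤ ‖a‖` by the square root of `a`. -/
theorem mul_self_le_norm_smul {A : Type*} [CStarAlgebra A] [PartialOrder A] [StarOrderedRing A]
    {a : A} (ha : 0 ≤ a) : a * a ≤ ‖a‖ • a := by
  have h := CStarAlgebra.star_left_conjugate_le_norm_smul (a := CFC.sqrt a) (b := a)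
    (IsSelfAdjoint.of_nonneg ha)
  rw [(IsSelfAdjoint.of_nonneg (CFC.sqrt_nonneg a)).star_eq, CFC.sqrt_mul_sqrt_self a ha] at h
  refine le_of_eq_of_le ?_ h
  conv_rhs => enter [1, 2]; rw [← CFC.sqrt_mul_sqrt_self a ha]
  rw [← mul_assoc, mul_assoc, CFC.sqrt_mul_sqrt_self a ha]

/-- A faithful representation of a von Neumann algebra whose range is its own bicommutant. -/
structure IsVNRep (ρ : A →⋆ₐ[ℂ] (H →L[ℂ] H)) : Prop where
  injective : Function.Injective ρ
  mem_range : ∀ T, T ∈ (Set.range ρ).centralizer.centralizer → T ∈ Set.range ρ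

theorem re_inner_mono (ρ : A →⋆ₐ[ℂ] (H →L[ℂ] H)) {a b : A} (hab : a ≤ b) (ξ : H) :
    (⟪ρ a ξ, ξ⟫_ℂ).re ≤ (⟪ρ b ξ, ξ⟫_ℂ).re := by
  have h : (ρ b - ρ a).IsPositive := OrderHomClass.mono ρ hab
  have := h.re_inner_nonneg_left ξ
  rw [sub_apply, inner_sub_left, map_sub] at this
  exact sub_nonneg.mp this

theorem inner_map_map (ρ : A →⋆ₐ[ℂ] (H →L[ℂ] H)) (a b : A) (ξ η : H) :
    ⟪ρ a ξ, ρ b η⟫_ℂ = ⟪ρ (star b * a) ξ, η⟫_ℂ := by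
  rw [map_mul, map_star, ContinuousLinearMap.star_eq_adjoint, mul_apply_eq_comp,
    ContinuousLinearMap.adjoint_inner_left]

theorem norm_map_sq (ρ : A →⋆ₐ[ℂ] (H →L[ℂ] H)) (a : A) (ξ : H) :
    ‖ρ a ξ‖ ^ 2 = (⟪ρ (star a * a) ξ, ξ⟫_ℂ).re := by
  rw [← inner_map_map, inner_self_eq_norm_sq_to_K]
  norm_cast

/-- This turns convergence of the monotone quadratic forms into norm convergence of the vectors,
which drives Vigier's theorem. -/
theorem norm_map_sq_le (ρ : A →⋆ₐ[ℂ] (H →L[ℂ] H)) {a : A} (ha : 0 ≤ a) (ξ : H) :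
    ‖ρ a ξ‖ ^ 2 ≤ ‖a‖ * (⟪ρ a ξ, ξ⟫_ℂ).re := by
  rw [norm_map_sq, (IsSelfAdjoint.of_nonneg ha).star_eq]
  refine (re_inner_mono ρ (mul_self_le_norm_smul ha) ξ).trans_eq ?_
  have h : ρ (‖a‖ • a) = (‖a‖ : ℂ) • ρ a := by
    rw [← map_smul, Complex.coe_smul]
  rw [h, smul_apply, inner_smul_left]
  simp

theorem norm_map_apply_le (ρ : A →⋆ₐ[ℂ] (H →L[ℂ] H)) (a : A) (ξ : H) :
    ‖ρ a ξ‖ ≤ ‖a‖ * ‖ξ‖ :=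
  ((ρ a).le_opNorm ξ).trans
    (mul_le_mul_of_nonneg_right (NonUnitalStarAlgHom.norm_apply_le ρ a) (norm_nonneg ξ))

/-- **Vigier's theorem**: a bounded directed family of self-adjoint operators converges strongly. -/
theorem exists_tendsto_of_directedOn (ρ : A →⋆ₐ[ℂ] (H →L[ℂ] H)) {D : Set A} (hne : D.Nonempty)
    (hdir : DirectedOn (· ≤ ·) D) (hbdd : BddAbove D) :
    ∃ T : H →L[ℂ] H, ∀ ξ, Tendsto (fun d : D => ρ d ξ) atTop (𝓝 (T ξ)) := by
  obtain ⟨u, hu⟩ := hbdd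
  obtain ⟨d₀, hd₀⟩ := hne
  have : Nonempty D := ⟨⟨d₀, hd₀⟩⟩
  have : IsDirectedOrder D := isDirectedOrder_coe hdir
  set C := ‖u - d₀‖
  have hC : ∀ e d : D, d₀ ≤ e → e ≤ d → ‖(d : A) - e‖ ≤ C := fun e d he hed =>
    CStarAlgebra.norm_le_norm_of_nonneg_of_le (sub_nonneg.mpr hed) (sub_le_sub (hu d.2) he)
  have hest : ∀ (e d : D) (ξ : H), d₀ ≤ e → e ≤ d →
      ‖ρ d ξ - ρ e ξ‖ ^ 2 ≤ C * ((⟪ρ d ξ, ξ⟫_ℂ).re - (⟪ρ e ξ, ξ⟫_ℂ).re) := by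
    intro e d ξ he hed
    have h1 := norm_map_sq_le ρ (sub_nonneg.mpr hed) ξ
    have h2 := re_inner_mono ρ hed ξ
    rw [map_sub, sub_apply, inner_sub_left, Complex.sub_re] at h1
    exact h1.trans (mul_le_mul_of_nonneg_right (hC e d he hed) (sub_nonneg.mpr h2))
  have hlim : ∀ ξ : H, ∃ η, Tendsto (fun d : D => ρ d ξ) atTop (𝓝 η) := by
    intro ξ
    have hmono : Monotone fun d : D => (⟪ρ d ξ, ξ⟫_ℂ).re := fun _ _ h => re_inner_mono ρ h ξ
    have hb : BddAbove (Set.range fun d : D => (⟪ρ d ξ, ξ⟫_ℂ).re) :=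
      ⟨_, by rintro _ ⟨d, rfl⟩; exact re_inner_mono ρ (hu d.2) ξ⟩
    have ht := tendsto_atTop_ciSup hmono hb
    set q := ⨆ d : D, (⟪ρ d ξ, ξ⟫_ℂ).re
    refine cauchy_map_iff_exists_tendsto.mp (Metric.cauchy_iff.mpr ⟨inferInstance, fun ε hε => ?_⟩)
    -- `C + 1` replaces `C`, which may be zero.
    have hpos : 0 < (ε / 2) ^ 2 / (C + 1) := by positivity
    obtain ⟨e₁, he₁⟩ := (ht.eventually (lt_mem_nhds (sub_lt_self q hpos))).exists
    obtain ⟨e, hee, hed⟩ := exists_ge_ge e₁ (⟨d₀, hd₀⟩ : D)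
    refine ⟨_, image_mem_map (Ici_mem_atTop e), ?_⟩
    have key : ∀ d : D, e ≤ d → dist (ρ d ξ) (ρ e ξ) < ε / 2 := by
      intro d hd
      rw [dist_eq_norm]
      refine lt_of_pow_lt_pow_left₀ 2 (by positivity) ?_
      refine (hest e d ξ hed hd).trans_lt ?_
      have h1 : (⟪ρ d ξ, ξ⟫_ℂ).re ≤ q := le_ciSup hb d
      have h2 : (⟪ρ e₁ ξ, ξ⟫_ℂ).re ≤ (⟪ρ e ξ, ξ⟫_ℂ).re := hmono hee
      have h3 := hmono hd
      have hC0 : 0 ≤ C := norm_nonneg _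
      calc C * ((⟪ρ d ξ, ξ⟫_ℂ).re - (⟪ρ e ξ, ξ⟫_ℂ).re)
          ≤ (C + 1) * ((⟪ρ d ξ, ξ⟫_ℂ).re - (⟪ρ e ξ, ξ⟫_ℂ).re) :=
            mul_le_mul_of_nonneg_right (by linarith) (sub_nonneg.mpr h3)
        _ < (C + 1) * ((ε / 2) ^ 2 / (C + 1)) :=
            mul_lt_mul_of_pos_left (by linarith) (by linarith)
        _ = (ε / 2) ^ 2 := by field_simp
    rintro _ ⟨d, hd, rfl⟩ _ ⟨d', hd', rfl⟩
    exact (dist_triangle_right _ _ (ρ e ξ)).trans_lt (by linarith [key d hd, key d' hd'])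
  choose f hf using hlim
  refine ⟨LinearMap.mkContinuous (linearMapOfTendsto f (fun d : D => (ρ d : H →ₗ[ℂ] H))
    (tendsto_pi_nhds.mpr hf)) (C + ‖d₀‖) fun ξ => ?_, hf⟩
  refine le_of_tendsto (hf ξ).norm ?_
  filter_upwards [Ici_mem_atTop (⟨d₀, hd₀⟩ : D)] with d hd
  refine (norm_map_apply_le ρ d ξ).trans (mul_le_mul_of_nonneg_right ?_ (norm_nonneg ξ))
  calc ‖(d : A)‖ = ‖((d : A) - d₀) + d₀‖ := by rw [sub_add_cancel]
    _ ≤ ‖(d : A) - d₀‖ + ‖d₀‖ := norm_add_le _ _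
    _ ≤ C + ‖d₀‖ := by
      have := hC ⟨d₀, hd₀⟩ d le_rfl hd
      linarith

namespace IsVNRep

theorem nonneg_of_isPositive {ρ : A →⋆ₐ[ℂ] (H →L[ℂ] H)} (hρ : IsVNRep ρ) {a : A}
    (ha : (ρ a).IsPositive) : 0 ≤ a := by
  refine nonneg_of_forall_map_nonneg (ι := Unit) (fun _ => (ρ : A →⋆ₙₐ[ℂ] (H →L[ℂ] H)))
    (fun b hb => ?_) fun _ => (ContinuousLinearMap.nonneg_iff_isPositive _).mpr ha
  exact hρ.injective ((hb ()).trans (map_zero ρ).symm)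

theorem le_of_re_inner_le {ρ : A →⋆ₐ[ℂ] (H →L[ℂ] H)} (hρ : IsVNRep ρ) {a b : A}
    (ha : IsSelfAdjoint a) (hb : IsSelfAdjoint b)
    (h : ∀ ξ, (⟪ρ a ξ, ξ⟫_ℂ).re ≤ (⟪ρ b ξ, ξ⟫_ℂ).re) : a ≤ b := by
  rw [← sub_nonneg]
  refine hρ.nonneg_of_isPositive (ContinuousLinearMap.isPositive_def'.mpr ⟨(hb.sub ha).map ρ, ?_⟩)
  intro ξ
  rw [ContinuousLinearMap.reApplyInnerSelf_apply, map_sub, sub_apply,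
    inner_sub_left, map_sub]
  exact sub_nonneg.mpr (h ξ)

/-- A bounded directed set of self-adjoint elements has a supremum, to which it converges
strongly. -/
theorem exists_isLUB {ρ : A →⋆ₐ[ℂ] (H →L[ℂ] H)} (hρ : IsVNRep ρ) {D : Set A} (hne : D.Nonempty)
    (hdir : DirectedOn (· ≤ ·) D) (hsa : ∀ a ∈ D, IsSelfAdjoint a) (hbdd : BddAbove D) :
    ∃ s, IsLUB D s ∧ ∀ ξ, Tendsto (fun d : D => ρ d ξ) atTop (𝓝 (ρ s ξ)) := by
  obtain ⟨T, hT⟩ := exists_tendsto_of_directedOn ρ hne hdir hbdd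
  have : Nonempty D := hne.to_subtype
  have : IsDirectedOrder D := isDirectedOrder_coe hdir
  -- Commuting with a fixed operator survives strong limits, so `T` lies in the bicommutant of the
  -- range.
  obtain ⟨s, rfl⟩ : T ∈ Set.range ρ := by
    refine hρ.mem_range T fun S hS => ?_
    ext ξ
    refine tendsto_nhds_unique ((S.continuous.tendsto _).comp (hT ξ)) ?_
    refine (hT (S ξ)).congr fun d => ?_
    exact DFunLike.congr_fun (hS (ρ d) ⟨d, rfl⟩) ξ
  have hs : IsSelfAdjoint s := by
    refine hρ.injective ?_
    rw [map_star]
    refine ((ContinuousLinearMap.isSelfAdjoint_iff_isSymmetric).mpr fun ξ η => ?_).star_eq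
    refine tendsto_nhds_unique ((hT ξ).inner tendsto_const_nhds)
      ((tendsto_const_nhds.inner (hT η)).congr fun d => ?_)
    exact (ContinuousLinearMap.isSelfAdjoint_iff_isSymmetric.mp ((hsa d d.2).map ρ) ξ η).symm
  have hq : ∀ ξ, Tendsto (fun d : D => (⟪ρ d ξ, ξ⟫_ℂ).re) atTop (𝓝 (⟪ρ s ξ, ξ⟫_ℂ).re) :=
    fun ξ => (Complex.continuous_re.tendsto _).comp ((hT ξ).inner tendsto_const_nhds)
  refine ⟨s, ⟨fun d hd => ?_, fun t ht => ?_⟩, hT⟩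
  · refine hρ.le_of_re_inner_le (hsa d hd) hs fun ξ => ?_
    exact Monotone.ge_of_tendsto (f := fun d : D => (⟪ρ d ξ, ξ⟫_ℂ).re)
      (fun _ _ h => re_inner_mono ρ h ξ) (hq ξ) ⟨d, hd⟩
  · obtain ⟨d, hd⟩ := hne
    have ht' : IsSelfAdjoint t := isSelfAdjoint_of_le (hsa d hd) (ht hd)
    exact hρ.le_of_re_inner_le hs ht' fun ξ =>
      le_of_tendsto' (hq ξ) fun d => re_inner_mono ρ (ht d.2) ξ

/-- Suprema are unique, so an abstract supremum is the strong limit found by Vigier's theorem. -/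
theorem tendsto_of_isLUB {ρ : A →⋆ₐ[ℂ] (H →L[ℂ] H)} (hρ : IsVNRep ρ) {D : Set A} {s : A}
    (hne : D.Nonempty) (hdir : DirectedOn (· ≤ ·) D) (hsa : ∀ a ∈ D, IsSelfAdjoint a)
    (hs : IsLUB D s) (ξ : H) : Tendsto (fun d : D => ρ d ξ) atTop (𝓝 (ρ s ξ)) := by
  obtain ⟨s', hs', h⟩ := hρ.exists_isLUB hne hdir hsa ⟨s, hs.1⟩
  rw [hs.unique hs']
  exact h ξ

/-- A ⋆-homomorphism that is spatially a compression is normal. -/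
theorem isNormalMap_of_compression {ρ : A →⋆ₐ[ℂ] (H →L[ℂ] H)} (hρ : IsVNRep ρ)
    {σ : B →⋆ₐ[ℂ] (K →L[ℂ] K)} (hσ : IsVNRep σ) (h : A →⋆ₐ[ℂ] B) (V : K →L[ℂ] H)
    (W : H →L[ℂ] K) (hV : ∀ a, σ (h a) = W ∘L ρ a ∘L V) : IsNormalMap h := by
  intro D s hne hdir hsa hs
  have : Nonempty D := hne.to_subtype
  have : IsDirectedOrder D := isDirectedOrder_coe hdir
  have hmono : Monotone h := OrderHomClass.mono h
  obtain ⟨d₀, hd₀⟩ := hne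
  have hssa : IsSelfAdjoint s := isSelfAdjoint_of_le (hsa d₀ hd₀) (hs.1 hd₀)
  refine ⟨?_, fun t ht => ?_⟩
  · rintro _ ⟨a, ha, rfl⟩
    exact hmono (hs.1 ha)
  · have ht' : IsSelfAdjoint t  :=
      isSelfAdjoint_of_le ((hsa d₀ hd₀).map h) (ht ⟨d₀, hd₀, rfl⟩)
    refine hσ.le_of_re_inner_le (hssa.map h) ht' fun ξ => ?_
    have hlim : Tendsto (fun d : D => (⟪σ (h d) ξ, ξ⟫_ℂ).re) atTop
        (𝓝 (⟪σ (h s) ξ, ξ⟫_ℂ).re) := by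
      simp only [hV]
      exact (Complex.continuous_re.tendsto _).comp (((W.continuous.tendsto _).comp
        (hρ.tendsto_of_isLUB ⟨d₀, hd₀⟩ hdir hsa hs (V ξ))).inner tendsto_const_nhds)
    exact le_of_tendsto' hlim fun d => re_inner_mono σ (ht ⟨d, d.2, rfl⟩) ξ

end IsVNRep

/-- Every von Neumann algebra has a faithful representation as a bicommutant. -/
theorem VNAlg.exists_isVNRep (A : VNAlg.{u}) :
    ∃ (H : Type u) (_ : NormedAddCommGroup H) (_ : InnerProductSpace ℂ H) (_ : CompleteSpace H)
      (ρ : A →⋆ₐ[ℂ] (H →L[ℂ] H)), IsVNRep ρ := by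
  obtain ⟨H, i₁, i₂, i₃, N, ⟨e⟩⟩ := A.isVonNeumann
  refine ⟨H, i₁, i₂, i₃, N.toStarSubalgebra.subtype.comp (e : A →⋆ₐ[ℂ] N.toStarSubalgebra), ?_, ?_⟩
  · exact Subtype.val_injective.comp e.injective
  · intro T hT
    have hr : Set.range (N.toStarSubalgebra.subtype.comp (e : A →⋆ₐ[ℂ] N.toStarSubalgebra)) =
        (N : Set (H →L[ℂ] H)) := by
      ext x
      refine ⟨?_, fun hx => ⟨e.symm ⟨x, hx⟩, ?_⟩⟩
      · rintro ⟨a, rfl⟩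
        exact (e a).2
      · simp
    rw [hr] at hT ⊢
    rwa [N.centralizer_centralizer] at hT

namespace VonNeumannAlgebra

variable {H : Type u} [NormedAddCommGroup H] [InnerProductSpace ℂ H] [CompleteSpace H]

theorem isClosed_coe (M : VonNeumannAlgebra H) : IsClosed (M : Set (H →L[ℂ] H)) := by
  rw [← M.centralizer_centralizer]
  exact Set.isClosed_centralizer _

/-- A concrete von Neumann algebra as an object of the categories of von Neumann algebras. -/
noncomputable def toVNAlg (M : VonNeumannAlgebra H) : VNAlg.{u} :=
  letI : IsClosed (M.toStarSubalgebra : Set (H →L[ℂ] H)) := M.isClosed_coe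
  letI : CStarAlgebra M.toStarSubalgebra := StarSubalgebra.cstarAlgebra M.toStarSubalgebra
  { carrier := M.toStarSubalgebra
    cstar := inferInstance
    order := CStarAlgebra.spectralOrder _
    starOrdered := CStarAlgebra.spectralOrderedRing _
    isVonNeumann := ⟨H, _, _, inferInstance, M, ⟨StarAlgEquiv.refl _ _⟩⟩ }

/-- The defining representation of a concrete von Neumann algebra. -/
noncomputable def rep (M : VonNeumannAlgebra H) : M.toVNAlg →⋆ₐ[ℂ] (H →L[ℂ] H) :=
  M.toStarSubalgebra.subtype

theorem range_rep (M : VonNeumannAlgebra H) : Set.range M.rep = (M : Set (H →L[ℂ] H)) :=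
  Subtype.range_coe

theorem isVNRep_rep (M : VonNeumannAlgebra H) : IsVNRep M.rep where
  injective := Subtype.val_injective
  mem_range T hT := by
    rw [range_rep] at hT ⊢
    rwa [M.centralizer_centralizer] at hT

end VonNeumannAlgebra

end Representation

/-! ### Normal ⋆-homomorphisms are determined by their values on a generating set -/

section Uniqueness

open Filter Topology
open scoped InnerProductSpace

variable {A B : VNAlg.{u}}
variable {H : Type*} [NormedAddCommGroup H] [InnerProductSpace ℂ H] [CompleteSpace H]
variable {K : Type*} [NormedAddCommGroup K] [InnerProductSpace ℂ K] [CompleteSpace K]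

/-- A representation whose vector functionals preserve directed suprema. -/
def IsNormalRep (τ : A →⋆ₐ[ℂ] (K →L[ℂ] K)) : Prop :=
  ∀ (D : Set A) (s : A), D.Nonempty → DirectedOn (· ≤ ·) D → (∀ a ∈ D, IsSelfAdjoint a) →
    IsLUB D s → ∀ (ζ : K) (r : ℝ), (∀ d ∈ D, (⟪τ d ζ, ζ⟫_ℂ).re ≤ r) → (⟪τ s ζ, ζ⟫_ℂ).re ≤ r

theorem IsVNRep.isNormalRep {ρ : A →⋆ₐ[ℂ] (H →L[ℂ] H)} (hρ : IsVNRep ρ) : IsNormalRep ρ := by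
  intro D s hne hdir hsa hs ζ r hr
  have : Nonempty D := hne.to_subtype
  have : IsDirectedOrder D := isDirectedOrder_coe hdir
  exact le_of_tendsto' ((Complex.continuous_re.tendsto _).comp
    ((hρ.tendsto_of_isLUB hne hdir hsa hs ζ).inner tendsto_const_nhds)) fun d => hr d d.2

theorem IsNormalRep.comp {σ : B →⋆ₐ[ℂ] (K →L[ℂ] K)} (hσ : IsNormalRep σ) (h : NMIUHom A B) :
    IsNormalRep (σ.comp h.toStarAlgHom) := by
  intro D s hne hdir hsa hs ζ r hr
  refine hσ (h.toStarAlgHom '' D) (h.toStarAlgHom s) (hne.image _) ?_ ?_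
    (h.normal D s hne hdir hsa hs) ζ r ?_
  · rintro _ ⟨a, ha, rfl⟩ _ ⟨b, hb, rfl⟩
    obtain ⟨c, hc, hac, hbc⟩ := hdir a ha b hb
    exact ⟨_, ⟨c, hc, rfl⟩, h.monotone hac, h.monotone hbc⟩
  · rintro _ ⟨a, ha, rfl⟩
    exact (hsa a ha).map _
  · rintro _ ⟨a, ha, rfl⟩
    exact hr a ha

theorem re_inner_smul (τ : A →⋆ₐ[ℂ] (K →L[ℂ] K)) (r : ℝ) (a : A) (ζ : K) :
    (⟪τ (r • a) ζ, ζ⟫_ℂ).re = r * (⟪τ a ζ, ζ⟫_ℂ).re := by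
  have h : τ (r • a) = (r : ℂ) • τ a := by rw [← map_smul, Complex.coe_smul]
  rw [h, smul_apply, inner_smul_left]
  simp

theorem re_inner_add (τ : A →⋆ₐ[ℂ] (K →L[ℂ] K)) (a b : A) (ζ : K) :
    (⟪τ (a + b) ζ, ζ⟫_ℂ).re = (⟪τ a ζ, ζ⟫_ℂ).re + (⟪τ b ζ, ζ⟫_ℂ).re := by
  rw [map_add, add_apply, inner_add_left, Complex.add_re]

/-- A bounded set of positive elements that is closed under suprema of chains has a maximal
element. -/
theorem VNAlg.exists_maximal (A : VNAlg.{u}) {P : Set A} {q : A} (h0 : 0 ∈ P)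
    (hP : ∀ a ∈ P, 0 ≤ a ∧ a ≤ q)
    (hsup : ∀ c ⊆ P, c.Nonempty → DirectedOn (· ≤ ·) c → ∀ s, IsLUB c s → s ∈ P) :
    ∃ m ∈ P, ∀ c, 0 ≤ c → m + c ∈ P → c = 0 := by
  obtain ⟨H, _, _, _, ρ, hρ⟩ := A.exists_isVNRep
  obtain ⟨m, -, hm⟩ := zorn_le_nonempty₀ P (fun c hc hchain y hy => by
    obtain ⟨s, hs, -⟩ := hρ.exists_isLUB ⟨y, hy⟩ hchain.directedOn
      (fun a ha => IsSelfAdjoint.of_nonneg (hP a (hc ha)).1) ⟨q, fun a ha => (hP a (hc ha)).2⟩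
    exact ⟨s, hsup c hc ⟨y, hy⟩ hchain.directedOn s hs, hs.1⟩) 0 h0
  refine ⟨m, hm.prop, fun c hc hmc => le_antisymm ?_ hc⟩
  simpa using hm.le_of_ge hmc (le_add_of_nonneg_right hc)

/-- The vector `ζ` is dominated by a vector of the representation `ρ`. -/
def IsDominated (ρ : A →⋆ₐ[ℂ] (H →L[ℂ] H)) (τ : A →⋆ₐ[ℂ] (K →L[ℂ] K)) (ζ : K) : Prop :=
  ∃ ξ : H, ∀ T : A, ‖τ T ζ‖ ≤ ‖ρ T ξ‖

/-- A normal vector functional is dominated by a vector functional of a faithful representation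
below some positive element on which it does not vanish. -/
theorem exists_re_inner_le {ρ : A →⋆ₐ[ℂ] (H →L[ℂ] H)} (hρ : IsVNRep ρ)
    {τ : A →⋆ₐ[ℂ] (K →L[ℂ] K)} (hτ : IsNormalRep τ) {ζ : K} (hζ : ζ ≠ 0) :
    ∃ (b : A) (ξ : H), 0 ≤ b ∧ b ≤ 1 ∧ (⟪τ b ζ, ζ⟫_ℂ).re ≠ 0 ∧
      ∀ c, 0 ≤ c → c ≤ b → (⟪τ c ζ, ζ⟫_ℂ).re ≤ (⟪ρ c ξ, ξ⟫_ℂ).re := by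
  have hsa : ∀ {P : Set A} {q : A}, (∀ a ∈ P, 0 ≤ a ∧ a ≤ q) → ∀ c ⊆ P, ∀ a ∈ c,
      IsSelfAdjoint a := fun hP c hc a ha => IsSelfAdjoint.of_nonneg (hP a (hc ha)).1
  have hbd : ∀ {P : Set A} {q : A}, (∀ a ∈ P, 0 ≤ a ∧ a ≤ q) → ∀ c ⊆ P, c.Nonempty → ∀ s,
      IsLUB c s → 0 ≤ s ∧ s ≤ q := by
    intro P q hP c hc hne s hs
    obtain ⟨a, ha⟩ := hne
    exact ⟨(hP a (hc ha)).1.trans (hs.1 ha), hs.2 fun a ha => (hP a (hc ha)).2⟩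
  have hP : ∀ a ∈ {a : A | (0 ≤ a ∧ a ≤ 1) ∧ (⟪τ a ζ, ζ⟫_ℂ).re ≤ 0}, 0 ≤ a ∧ a ≤ 1 :=
    fun a ha => ha.1
  -- Removing a maximal element of the unit interval on which the functional of `ζ` is nonpositive
  -- leaves `q`, below which the functional is faithful.
  obtain ⟨m, ⟨⟨hm0, hm1⟩, hm⟩, hmax⟩ := A.exists_maximal (by simp) hP
    fun c hc hne hdir s hs => ⟨hbd hP c hc hne s hs,
      hτ c s hne hdir (hsa hP c hc) hs ζ 0 fun d hd => (hc hd).2⟩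
  obtain ⟨q, hq⟩ : ∃ q, q = 1 - m := ⟨_, rfl⟩
  have hq0 : 0 ≤ q := hq ▸ sub_nonneg.mpr hm1
  have hq1 : q ≤ 1 := hq ▸ sub_le_self 1 hm0
  have hfaith : ∀ b, 0 ≤ b → b ≤ q → (⟪τ b ζ, ζ⟫_ℂ).re ≤ 0 → b = 0 := by
    intro b hb hbq hb0
    refine hmax b hb ⟨⟨add_nonneg hm0 hb, ?_⟩, ?_⟩
    · rw [hq] at hbq
      exact le_sub_iff_add_le'.mp hbq
    · rw [re_inner_add]
      exact add_nonpos hm hb0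
  have hτq : 0 < (⟪τ q ζ, ζ⟫_ℂ).re := by
    have h1 : (⟪τ 1 ζ, ζ⟫_ℂ).re = ‖ζ‖ ^ 2 := by
      have := norm_map_sq τ 1 ζ
      rw [star_one, one_mul] at this
      rw [← this, map_one]
      rfl
    have h2 := re_inner_add τ m q ζ
    rw [hq, add_sub_cancel, h1] at h2
    have h3 : 0 < ‖ζ‖ ^ 2 := by positivity
    rw [hq]
    linarith
  obtain ⟨v, hv⟩ : ∃ v, 0 < (⟪ρ q v, v⟫_ℂ).re := by
    by_contra! hall
    have : q ≤ 0 := hρ.le_of_re_inner_le (IsSelfAdjoint.of_nonneg hq0) (IsSelfAdjoint.zero _)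
      fun ξ => by simpa using hall ξ
    rw [le_antisymm this hq0] at hτq
    simp at hτq
  -- The summand `1` gives `t ≤ t * t` and makes the inequality at `q` strict.
  obtain ⟨t, ht⟩ : ∃ t : ℝ, t = (⟪τ q ζ, ζ⟫_ℂ).re / (⟪ρ q v, v⟫_ℂ).re + 1 := ⟨_, rfl⟩
  have ht1 : 1 ≤ t := by
    rw [ht]
    have : 0 ≤ (⟪τ q ζ, ζ⟫_ℂ).re / (⟪ρ q v, v⟫_ℂ).re := by positivity
    linarith
  obtain ⟨ξ, hξ⟩ : ∃ ξ, (⟪τ q ζ, ζ⟫_ℂ).re < (⟪ρ q ξ, ξ⟫_ℂ).re := by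
    refine ⟨(t : ℂ) • v, ?_⟩
    have h1 : (⟪ρ q ((t : ℂ) • v), (t : ℂ) • v⟫_ℂ).re = t * t * (⟪ρ q v, v⟫_ℂ).re := by
      rw [map_smul, inner_smul_left, inner_smul_right]
      simp [mul_assoc]
    have h2 : t * (⟪ρ q v, v⟫_ℂ).re = (⟪τ q ζ, ζ⟫_ℂ).re + (⟪ρ q v, v⟫_ℂ).re := by
      rw [ht]
      field_simp
    rw [h1, mul_assoc, h2]
    nlinarith
  have hP' : ∀ a ∈ {a : A | (0 ≤ a ∧ a ≤ q) ∧ (⟪ρ a ξ, ξ⟫_ℂ).re ≤ (⟪τ a ζ, ζ⟫_ℂ).re},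
      0 ≤ a ∧ a ≤ q := fun a ha => ha.1
  -- Here `m'` is maximal among the elements below `q` on which the desired domination is reversed.
  -- It cannot be `q` by the choice of `ξ`, and a violation below `q - m'` could be added to it.
  obtain ⟨m', ⟨⟨hm'0, hm'q⟩, hm'⟩, hmax'⟩ := A.exists_maximal (by simpa using hq0) hP'
    fun c hc hne hdir s hs => ⟨hbd hP' c hc hne s hs,
      hρ.isNormalRep c s hne hdir (hsa hP' c hc) hs ξ _ fun d hd =>
        (hc hd).2.trans (re_inner_mono τ (hs.1 hd) ζ)⟩
  have hb0 : 0 ≤ q - m' := sub_nonneg.mpr hm'q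
  have hbq : q - m' ≤ q := sub_le_self q hm'0
  refine ⟨q - m', ξ, hb0, hbq.trans hq1, fun h => ?_, fun c hc hcb => ?_⟩
  · have h1 := hfaith _ hb0 hbq h.le
    rw [sub_eq_zero] at h1
    rw [h1] at hξ
    exact absurd hm' (not_le.mpr hξ)
  · by_contra! hlt
    have hc0 : c = 0 := by
      refine hmax' c hc ⟨⟨add_nonneg hm'0 hc, le_sub_iff_add_le'.mp hcb⟩, ?_⟩
      rw [re_inner_add, re_inner_add]
      exact add_le_add hm' hlt.le
    rw [hc0] at hlt
    simp at hlt

/-- The dominated vectors of a normal representation have trivial orthogonal complement. -/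
theorem exists_isDominated {ρ : A →⋆ₐ[ℂ] (H →L[ℂ] H)} (hρ : IsVNRep ρ)
    {τ : A →⋆ₐ[ℂ] (K →L[ℂ] K)} (hτ : IsNormalRep τ) {ζ : K}
    (h : ∀ η, IsDominated ρ τ η → ⟪η, ζ⟫_ℂ = 0) : ζ = 0 := by
  by_contra hζ
  obtain ⟨b, ξ, hb0, hb1, hb, hdom⟩ := exists_re_inner_le hρ hτ hζ
  have hbb : b * b ≤ b := by
    refine (mul_self_le_norm_smul hb0).trans ?_
    have : ‖b‖ ≤ 1 := (CStarAlgebra.norm_le_one_iff_of_nonneg b).mpr hb1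
    simpa using smul_le_smul_of_nonneg_right this hb0
  refine hb ?_
  rw [h (τ b ζ) ⟨ρ b ξ, fun T => ?_⟩, Complex.zero_re]
  rw [← mul_apply_eq_comp, ← mul_apply_eq_comp, ← map_mul, ← map_mul]
  refine le_of_sq_le_sq ?_ (norm_nonneg _)
  rw [norm_map_sq, norm_map_sq]
  -- After rescaling, this element lies below `b`, where domination is known; so `ρ b ξ` dominates
  -- `τ b ζ`.
  have hc : star (T * b) * (T * b) ≤ (‖star T * T‖ + 1) • b := by
    have h1 : star (T * b) * (T * b) = star b * (star T * T) * b := by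
      rw [star_mul]
      simp only [mul_assoc]
    rw [h1]
    refine (CStarAlgebra.star_left_conjugate_le_norm_smul (IsSelfAdjoint.star_mul_self T)).trans ?_
    rw [(IsSelfAdjoint.of_nonneg hb0).star_eq]
    refine (smul_le_smul_of_nonneg_left hbb (norm_nonneg _)).trans ?_
    exact smul_le_smul_of_nonneg_right (by linarith) hb0
  have hr : 0 < ‖star T * T‖ + 1 := by positivity
  have h2 := hdom ((‖star T * T‖ + 1)⁻¹ • (star (T * b) * (T * b)))
    (smul_nonneg (by positivity) (star_mul_self_nonneg _)) (by
      refine (smul_le_smul_of_nonneg_left hc (by positivity)).trans_eq ?_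
      rw [smul_smul, inv_mul_cancel₀ hr.ne', one_smul])
  rw [re_inner_smul, re_inner_smul] at h2
  exact le_of_mul_le_mul_left h2 (by positivity)

/-- Matrix coefficients at dominated vectors are matrix coefficients of `ρ`. -/
theorem IsDominated.exists_inner_eq {ρ : A →⋆ₐ[ℂ] (H →L[ℂ] H)} {τ : A →⋆ₐ[ℂ] (K →L[ℂ] K)} {ζ : K}
    (h : IsDominated ρ τ ζ) (η : K) : ∃ ξ θ : H, ∀ T : A, ⟪η, τ T ζ⟫_ℂ = ⟪θ, ρ T ξ⟫_ℂ := by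
  obtain ⟨ξ, hξ⟩ := h
  let L : A →ₗ[ℂ] H := (ContinuousLinearMap.apply ℂ H ξ).toLinearMap ∘ₗ ρ.toAlgHom.toLinearMap
  let g : A →ₗ[ℂ] ℂ := (innerSL ℂ η).toLinearMap ∘ₗ
    (ContinuousLinearMap.apply ℂ K ζ).toLinearMap ∘ₗ τ.toAlgHom.toLinearMap
  have hbound : ∀ T, ‖g T‖ ≤ ‖η‖ * ‖L T‖ := fun T =>
    (norm_inner_le_norm η (τ T ζ)).trans (mul_le_mul_of_nonneg_left (hξ T) (norm_nonneg _))
  have hker : LinearMap.ker L ≤ LinearMap.ker g := by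
    intro T hT
    have := hbound T
    rw [LinearMap.mem_ker.mp hT, norm_zero, mul_zero] at this
    exact LinearMap.mem_ker.mpr (norm_le_zero_iff.mp this)
  -- Domination makes the coefficient a bounded functional of `ρ T ξ`; Hahn–Banach and Riesz then
  -- supply `θ`.
  let f : LinearMap.range L →ₗ[ℂ] ℂ :=
    (LinearMap.ker L).liftQ g hker ∘ₗ L.quotKerEquivRange.symm.toLinearMap
  have hf : ∀ T, f ⟨L T, T, rfl⟩ = g T := by
    intro T
    have : L.quotKerEquivRange.symm ⟨L T, T, rfl⟩ = Submodule.Quotient.mk T := by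
      rw [LinearEquiv.symm_apply_eq]
      rfl
    change (LinearMap.ker L).liftQ g hker (L.quotKerEquivRange.symm ⟨L T, T, rfl⟩) = g T
    rw [this]
    rfl
  let f' : LinearMap.range L →L[ℂ] ℂ := f.mkContinuous ‖η‖ (by
    rintro ⟨_, T, rfl⟩
    rw [hf]
    exact hbound T)
  obtain ⟨F, hF, -⟩ := exists_extension_norm_eq _ f'
  refine ⟨ξ, (InnerProductSpace.toDual ℂ H).symm F, fun T => ?_⟩
  rw [InnerProductSpace.toDual_symm_apply]
  exact ((hF ⟨L T, T, rfl⟩).trans (hf T)).symm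

/-- Two normal representations that agree on a strongly dense set are equal. -/
theorem IsNormalRep.eq_of_dense {ρ : A →⋆ₐ[ℂ] (H →L[ℂ] H)} (hρ : IsVNRep ρ)
    {τ₁ τ₂ : A →⋆ₐ[ℂ] (K →L[ℂ] K)} (h₁ : IsNormalRep τ₁) (h₂ : IsNormalRep τ₂) {E : Set A}
    (hE : ∀ (T : A) (ξ : Fin 2 → H) (ε : ℝ), 0 < ε → ∃ s ∈ E, ∀ i, ‖ρ s (ξ i) - ρ T (ξ i)‖ < ε)
    (heq : ∀ s ∈ E, τ₁ s = τ₂ s) : τ₁ = τ₂ := by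
  have key : ∀ ζ₁ ζ₂, IsDominated ρ τ₁ ζ₁ → IsDominated ρ τ₂ ζ₂ → ∀ T,
      ⟪ζ₂, τ₁ T ζ₁⟫_ℂ = ⟪ζ₂, τ₂ T ζ₁⟫_ℂ := by
    intro ζ₁ ζ₂ hζ₁ hζ₂ T
    obtain ⟨ξ₁, θ₁, hθ₁⟩ := hζ₁.exists_inner_eq ζ₂
    obtain ⟨ξ₂, θ₂, hθ₂⟩ := hζ₂.exists_inner_eq ζ₁
    -- Only `ζ₂` is known to be dominated for `τ₂`, so its coefficient is treated through adjoints.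
    -- Hence two vectors must be approximated at once.
    have hθ₂' : ∀ T, ⟪ζ₂, τ₂ T ζ₁⟫_ℂ = ⟪ξ₂, ρ T θ₂⟫_ℂ := by
      intro T
      have h3 := congrArg (starRingEnd ℂ) (hθ₂ (star T))
      rw [inner_conj_symm, inner_conj_symm, map_star, map_star,
        ContinuousLinearMap.star_eq_adjoint, ContinuousLinearMap.star_eq_adjoint,
        ContinuousLinearMap.adjoint_inner_left, ContinuousLinearMap.adjoint_inner_left] at h3
      exact h3
    refine eq_of_forall_dist_le fun ε hε => ?_
    obtain ⟨s, hs, hlt⟩ := hE T ![ξ₁, θ₂] (ε / (‖θ₁‖ + ‖ξ₂‖ + 1)) (by positivity)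
    have h0 : ‖ρ s ξ₁ - ρ T ξ₁‖ < ε / (‖θ₁‖ + ‖ξ₂‖ + 1) := hlt 0
    have h1 : ‖ρ s θ₂ - ρ T θ₂‖ < ε / (‖θ₁‖ + ‖ξ₂‖ + 1) := hlt 1
    have hsum : ⟪ζ₂, τ₁ T ζ₁⟫_ℂ - ⟪ζ₂, τ₂ T ζ₁⟫_ℂ =
        ⟪ξ₂, ρ s θ₂ - ρ T θ₂⟫_ℂ - ⟪θ₁, ρ s ξ₁ - ρ T ξ₁⟫_ℂ := by
      rw [inner_sub_right, inner_sub_right, ← hθ₁, ← hθ₁, ← hθ₂', ← hθ₂', heq s hs]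
      ring
    rw [dist_eq_norm, hsum]
    calc ‖⟪ξ₂, ρ s θ₂ - ρ T θ₂⟫_ℂ - ⟪θ₁, ρ s ξ₁ - ρ T ξ₁⟫_ℂ‖
        ≤ ‖ξ₂‖ * ‖ρ s θ₂ - ρ T θ₂‖ + ‖θ₁‖ * ‖ρ s ξ₁ - ρ T ξ₁‖ :=
          (norm_sub_le _ _).trans (add_le_add (norm_inner_le_norm _ _) (norm_inner_le_norm _ _))
      _ ≤ ‖ξ₂‖ * (ε / (‖θ₁‖ + ‖ξ₂‖ + 1)) + ‖θ₁‖ * (ε / (‖θ₁‖ + ‖ξ₂‖ + 1)) := by gcongr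
      _ = ε * ((‖θ₁‖ + ‖ξ₂‖) / (‖θ₁‖ + ‖ξ₂‖ + 1)) := by ring
      _ ≤ ε * 1 := by
          refine mul_le_mul_of_nonneg_left ?_ hε.le
          rw [div_le_one (by positivity)]
          linarith
      _ = ε := mul_one ε
  ext T v
  have hgood : ∀ ζ₁, IsDominated ρ τ₁ ζ₁ → (τ₁ T - τ₂ T) ζ₁ = 0 := fun ζ₁ hζ₁ =>
    exists_isDominated hρ h₂ fun ζ₂ hζ₂ => by
      rw [sub_apply, inner_sub_right, key ζ₁ ζ₂ hζ₁ hζ₂, sub_self]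
  -- The difference kills all `τ₁`-dominated vectors, so the range of its adjoint is orthogonal to
  -- them.
  have hadj : ContinuousLinearMap.adjoint (τ₁ T - τ₂ T) = 0 := by
    ext η
    refine exists_isDominated hρ h₁ fun ζ₁ hζ₁ => ?_
    rw [ContinuousLinearMap.adjoint_inner_right, hgood ζ₁ hζ₁, inner_zero_left]
  have : τ₁ T - τ₂ T = 0 := by
    rw [← ContinuousLinearMap.adjoint_adjoint (τ₁ T - τ₂ T), hadj, map_zero]
  rw [sub_eq_zero.mp this]

/-- Normal unital ⋆-homomorphisms out of a generated von Neumann algebra are determined by their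
values on the generators. -/
theorem NMIUHom.ext_of_generatedBy {H : Type u} [NormedAddCommGroup H] [InnerProductSpace ℂ H]
    [CompleteSpace H] {X : Set (H →L[ℂ] H)}
    {h₁ h₂ : NMIUHom (VonNeumannAlgebra.generatedBy X).toVNAlg B}
    (h : ∀ x, (VonNeumannAlgebra.generatedBy X).rep x ∈ X →
      h₁.toStarAlgHom x = h₂.toStarAlgHom x) : h₁ = h₂ := by
  obtain ⟨K, _, _, _, σ, hσ⟩ := B.exists_isVNRep
  let M := VonNeumannAlgebra.generatedBy X
  let E : StarSubalgebra ℂ M.toVNAlg := StarAlgHom.equalizer h₁.toStarAlgHom h₂.toStarAlgHom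
  have hX : StarAlgebra.adjoin ℂ X ≤ E.map M.rep := by
    refine StarAlgebra.adjoin_le fun x hx => ?_
    have : x ∈ Set.range M.rep := by
      rw [M.range_rep]
      exact VonNeumannAlgebra.subset_generatedBy X hx
    obtain ⟨y, rfl⟩ := this
    exact ⟨y, h y hx, rfl⟩
  have heq := IsNormalRep.eq_of_dense M.isVNRep_rep (hσ.isNormalRep.comp h₁)
    (hσ.isNormalRep.comp h₂) (E := E) (fun T ξ ε hε => by
      have hT : M.rep T ∈ M := by
        have : M.rep T ∈ Set.range M.rep := ⟨T, rfl⟩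
        rwa [M.range_rep] at this
      obtain ⟨s, hs, hlt⟩ := VonNeumannAlgebra.exists_adjoin_norm_sub_lt hT ξ hε
      obtain ⟨e, he, rfl⟩ := hX hs
      exact ⟨e, he, hlt⟩) (fun s hs => congrArg σ hs)
  ext a
  exact hσ.injective (DFunLike.congr_fun heq a)

end Uniqueness

/-! ### Solution sets -/

section SolutionSet

variable {A B : VNAlg.{u}}

/-- A ⋆-homomorphism whose range lies in that of an injective one factors through it. -/
theorem exists_starAlgHom_lift {A B R : Type*} [Semiring A] [Algebra ℂ A] [StarRing A]
    [Semiring B] [Algebra ℂ B] [StarRing B] [Semiring R] [Algebra ℂ R] [StarRing R]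
    [StarModule ℂ R] (g : A →⋆ₐ[ℂ] R) (σ : B →⋆ₐ[ℂ] R) (hσ : Function.Injective σ)
    (h : ∀ a, g a ∈ Set.range σ) : ∃ k : A →⋆ₐ[ℂ] B, ∀ a, σ (k a) = g a := by
  choose k hk using h
  exact ⟨{
    toFun := k
    map_one' := hσ (by rw [hk, map_one, map_one])
    map_mul' := fun a b => hσ (by rw [hk, map_mul, map_mul, hk, hk])
    map_zero' := hσ (by rw [hk, map_zero, map_zero])
    map_add' := fun a b => hσ (by rw [hk, map_add, map_add, hk, hk])
    commutes' := fun r => hσ (by rw [hk, AlgHomClass.commutes, AlgHomClass.commutes])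
    map_star' := fun a => hσ (by rw [hk, map_star, map_star, hk]) }, hk⟩

/-- A linear map into the operators with values in a von Neumann algebra. -/
noncomputable def VonNeumannAlgebra.codRestrict {A : Type*} [AddCommMonoid A] [Module ℂ A]
    {H : Type u} [NormedAddCommGroup H] [InnerProductSpace ℂ H] [CompleteSpace H]
    (M : VonNeumannAlgebra H) (f : A →ₗ[ℂ] H →L[ℂ] H) (hf : ∀ a, f a ∈ M) : A →ₗ[ℂ] M.toVNAlg where
  toFun a := (⟨f a, hf a⟩ : M.toStarSubalgebra)
  map_add' a b := Subtype.ext (map_add f a b)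
  map_smul' r a := Subtype.ext (map_smul f r a)

/-- Every map in a reflected class factors through a von Neumann algebra of bounded cardinality. -/
theorem IsReflectedClass.exists_factorization {P : ∀ {A B : VNAlg.{u}}, (A →ₗ[ℂ] B) → Prop}
    (hP : IsReflectedClass.{u} P) {f : A →ₗ[ℂ] B} (hf : P f) :
    ∃ (C : VNAlg.{u}) (c : A →ₗ[ℂ] C) (h : NMIUHom C B), P c ∧
      Cardinal.mk C ≤ Cardinal.mk (Set (Set (A ⊕ ℂ))) ∧ ∀ a, h.toStarAlgHom (c a) = f a := by
  rcases subsingleton_or_nontrivial B with hB | hB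
  · exact ⟨B, f, NMIUHom.id B, hf, (Cardinal.le_one_iff_subsingleton.mpr hB).trans
      (Cardinal.one_le_iff_ne_zero.mpr (Cardinal.mk_ne_zero _)), fun _ => rfl⟩
  obtain ⟨K, _, _, _, σ, hσ⟩ := B.exists_isVNRep
  -- The scalars already lie in the generated algebra; listing them makes the generating set
  -- infinite, as the cardinality bound requires.
  let s : A ⊕ ℂ → K →L[ℂ] K := Sum.elim (fun a => σ (f a)) (fun z => z • 1)
  let M := VonNeumannAlgebra.generatedBy (Set.range s)
  have hsM : Set.range s ⊆ M := VonNeumannAlgebra.subset_generatedBy _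
  have hne : (1 : K →L[ℂ] K) ≠ 0 := fun h => one_ne_zero (α := B)
    (hσ.injective (by rw [map_one, map_zero, h]))
  have hinf : (Set.range s).Infinite := by
    refine (Set.infinite_range_of_injective (f := fun z : ℂ => z • (1 : K →L[ℂ] K))
      (smul_left_injective ℂ hne)).mono ?_
    rintro _ ⟨z, rfl⟩
    exact ⟨Sum.inr z, rfl⟩
  have hM : (M : Set (K →L[ℂ] K)) ⊆ Set.range σ := by
    intro T hT
    rw [VonNeumannAlgebra.coe_generatedBy] at hT
    refine hσ.mem_range T (Set.centralizer_subset (Set.centralizer_subset ?_) hT)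
    have h1 : Set.range s ⊆ Set.range σ := by
      rintro _ ⟨a | z, rfl⟩
      · exact ⟨f a, rfl⟩
      · exact ⟨z • 1, by simp [s]⟩
    refine Set.union_subset h1 fun x hx => ?_
    obtain ⟨b, hb⟩ := h1 hx
    exact ⟨star b, by rw [map_star, hb, star_star]⟩
  obtain ⟨k, hk⟩ := exists_starAlgHom_lift M.rep σ hσ.injective
    fun a => hM (M.range_rep ▸ Set.mem_range_self a)
  have hkn : IsNormalMap k := M.isVNRep_rep.isNormalMap_of_compression hσ k
    (ContinuousLinearMap.id ℂ K) (ContinuousLinearMap.id ℂ K) hk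
  let h : NMIUHom M.toVNAlg B := ⟨k, hkn⟩
  let c : A →ₗ[ℂ] M.toVNAlg := M.codRestrict (σ.toAlgHom.toLinearMap ∘ₗ f)
    fun a => hsM ⟨Sum.inl a, rfl⟩
  have hc : ∀ a, h.toStarAlgHom (c a) = f a := fun a => hσ.injective (hk (c a))
  refine ⟨M.toVNAlg, c, h, ?_, ?_, hc⟩
  · refine hP.reflect (ι := PUnit.{u + 1}) (fun _ => h) (fun b hb => ?_) fun _ => ?_
    · refine M.isVNRep_rep.injective ?_
      rw [← hk, map_zero]
      exact (congrArg σ (hb ⟨⟩)).trans (map_zero σ)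
    · have : h.toLin ∘ₗ c = f := LinearMap.ext hc
      rwa [this]
  · refine (VonNeumannAlgebra.mk_generatedBy_le hinf).trans ?_
    simp only [Cardinal.mk_set]
    exact Cardinal.power_le_power_left two_ne_zero
      (Cardinal.power_le_power_left two_ne_zero Cardinal.mk_range_le)

end SolutionSet

/-! ### Von Neumann algebras of bounded cardinality form a set, up to isomorphism -/

section Code

variable {Z : Type u}

/-- The operations of a von Neumann algebra, transported along a map to a fixed type. -/
def VNAlg.code (C : VNAlg.{u}) (e : C → Z) :
    (Z → Z → Z → Prop) × (Z → Z → Z → Prop) × (Z → Z → Prop) × (ℂ → Z → Z → Prop) × Z :=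
  (fun x y z => ∃ a b, e a = x ∧ e b = y ∧ e (a + b) = z,
    fun x y z => ∃ a b, e a = x ∧ e b = y ∧ e (a * b) = z,
    fun x z => ∃ a, e a = x ∧ e (star a) = z,
    fun r x z => ∃ a, e a = x ∧ e (r • a) = z, e 1)

/-- The graph of addition records the image of the carrier in `Z` (add `0`), so every point of `C`
has a partner in `C'`; equality of the other graphs makes the matching a ⋆-homomorphism. -/
theorem VNAlg.exists_starAlgHom_of_code_eq {C C' : VNAlg.{u}} {e : C → Z} {e' : C' → Z}
    (he' : Function.Injective e') (h : C.code e = C'.code e') :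
    ∃ k : C →⋆ₐ[ℂ] C', ∀ a, e' (k a) = e a := by
  simp only [code, Prod.mk.injEq] at h
  obtain ⟨hadd, hmul, hstar, hsmul, hone⟩ := h
  have hex : ∀ a, ∃ a', e' a' = e a := by
    intro a
    obtain ⟨a', -, ha', -⟩ := (congrFun (congrFun (congrFun hadd (e a)) (e 0)) (e (a + 0))).mp
      ⟨a, 0, rfl, rfl, rfl⟩
    exact ⟨a', ha'⟩
  choose k hk using hex
  have kadd : ∀ a b, k (a + b) = k a + k b := by
    intro a b
    obtain ⟨a', b', ha, hb, hab⟩ := (congrFun (congrFun (congrFun hadd (e a)) (e b))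
      (e (a + b))).mp ⟨a, b, rfl, rfl, rfl⟩
    rw [← he' (ha.trans (hk a).symm), ← he' (hb.trans (hk b).symm)]
    exact he' ((hk _).trans hab.symm)
  have kmul : ∀ a b, k (a * b) = k a * k b := by
    intro a b
    obtain ⟨a', b', ha, hb, hab⟩ := (congrFun (congrFun (congrFun hmul (e a)) (e b))
      (e (a * b))).mp ⟨a, b, rfl, rfl, rfl⟩
    rw [← he' (ha.trans (hk a).symm), ← he' (hb.trans (hk b).symm)]
    exact he' ((hk _).trans hab.symm)
  have kstar : ∀ a, k (star a) = star (k a) := by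
    intro a
    obtain ⟨a', ha, hs⟩ := (congrFun (congrFun hstar (e a)) (e (star a))).mp ⟨a, rfl, rfl⟩
    rw [← he' (ha.trans (hk a).symm)]
    exact he' ((hk _).trans hs.symm)
  have ksmul : ∀ (r : ℂ) a, k (r • a) = r • k a := by
    intro r a
    obtain ⟨a', ha, hs⟩ := (congrFun (congrFun (congrFun hsmul r) (e a)) (e (r • a))).mp
      ⟨a, rfl, rfl⟩
    rw [← he' (ha.trans (hk a).symm)]
    exact he' ((hk _).trans hs.symm)
  have kone : k 1 = 1 := he' ((hk 1).trans hone)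
  exact ⟨{
    toFun := k
    map_one' := kone
    map_mul' := kmul
    map_zero' := by simpa using ksmul 0 0
    map_add' := kadd
    commutes' := fun r => by
      rw [Algebra.algebraMap_eq_smul_one, Algebra.algebraMap_eq_smul_one, ksmul, kone]
    map_star' := kstar }, hk⟩

/-- Von Neumann algebras with the same code are isomorphic. -/
theorem VNAlg.exists_nmiuHom_of_code_eq {C C' : VNAlg.{u}} {e : C → Z} {e' : C' → Z}
    (he : Function.Injective e) (he' : Function.Injective e') (h : C.code e = C'.code e') :
    ∃ k : NMIUHom C C', ∀ a, e' (k.toStarAlgHom a) = e a := by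
  obtain ⟨k, hk⟩ := exists_starAlgHom_of_code_eq he' h
  obtain ⟨l, hl⟩ := exists_starAlgHom_of_code_eq he h.symm
  have hkl : ∀ t, k (l t) = t := fun t => he' ((hk _).trans (hl t))
  have hlk : ∀ a, l (k a) = a := fun a => he ((hl _).trans (hk a))
  refine ⟨⟨k, ?_⟩, hk⟩
  intro D s _ _ _ hs
  refine ⟨?_, fun t ht => ?_⟩
  · rintro _ ⟨d, hd, rfl⟩
    exact OrderHomClass.mono k (hs.1 hd)
  · rw [← hkl t]
    refine OrderHomClass.mono k (hs.2 fun d hd => ?_)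
    rw [← hlk d]
    exact OrderHomClass.mono l (ht ⟨d, hd, rfl⟩)

end Code

/-! ### The universal von Neumann algebra of a family of maps -/

section Product

open scoped InnerProductSpace

variable {I : Type u} {H : I → Type u} [∀ i, NormedAddCommGroup (H i)]
  [∀ i, InnerProductSpace ℂ (H i)]

/-- The inclusion of a summand in a Hilbert sum. -/
noncomputable def sumIncl (i : I) : H i →L[ℂ] lp H 2 :=
  open Classical in lp.singleContinuousLinearMap ℂ H 2 i

/-- The projection of a Hilbert sum onto a summand. -/
noncomputable def sumProj (i : I) : lp H 2 →L[ℂ] H i := lp.evalCLM ℂ H 2 i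

theorem sumProj_sumIncl (i : I) (v : H i) : sumProj i (sumIncl i v) = v :=
  open Classical in lp.single_apply_self 2 i v

theorem inner_sumIncl_left (i : I) (v : H i) (x : lp H 2) :
    ⟪sumIncl i v, x⟫_ℂ = ⟪v, sumProj i x⟫_ℂ :=
  open Classical in lp.inner_single_left i v x

theorem ext_sumIncl {S T : lp H 2 →L[ℂ] lp H 2} (h : ∀ i v, S (sumIncl i v) = T (sumIncl i v)) :
    S = T := by
  classical
  exact lp.ext_continuousLinearMap (by simp) fun i => ContinuousLinearMap.ext (h i)

theorem mapCLM_sumIncl {T : ∀ i, H i →L[ℂ] H i} {k : ℝ} (hk : 0 ≤ k) (hT : ∀ i, ‖T i‖ ≤ k) (i : I)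
    (v : H i) : lp.mapCLM 2 T hk hT (sumIncl i v) = sumIncl i (T i v) := by
  classical
  ext j
  by_cases h : j = i
  · subst h
    simp [sumIncl]
  · simp [sumIncl, h]

/-- An operator on a summand, extended by zero to the Hilbert sum. -/
noncomputable def sumExtend (i : I) (S : H i →L[ℂ] H i) : lp H 2 →L[ℂ] lp H 2 :=
  sumIncl i ∘L S ∘L sumProj i

theorem sumExtend_mem_centralizer {i : I} {Y : Set (H i →L[ℂ] H i)} {S : H i →L[ℂ] H i}
    (hS : S ∈ Y.centralizer) {X : Set (lp H 2 →L[ℂ] lp H 2)}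
    (hX : ∀ T ∈ X, ∃ y ∈ Y, (∀ v, T (sumIncl i v) = sumIncl i (y v)) ∧
      ∀ x, sumProj i (T x) = y (sumProj i x)) : sumExtend i S ∈ X.centralizer := by
  intro T hT
  obtain ⟨y, hy, hT1, hT2⟩ := hX T hT
  ext1 x
  change T (sumIncl i (S (sumProj i x))) = sumIncl i (S (sumProj i (T x)))
  rw [hT1, hT2]
  exact congrArg _ (DFunLike.congr_fun (hS y hy) (sumProj i x))

end Product

/-! ### Universal arrows from a small family of targets -/

section Universal

open scoped InnerProductSpace

/-- The constant comes from splitting `a` into four positive parts. Any bound independent of `f`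
suffices for block-diagonal operators to be bounded. -/
theorem norm_map_le_of_nonneg {A B : VNAlg.{u}} {f : A →ₗ[ℂ] B} (hf : ∀ a, 0 ≤ a → 0 ≤ f a)
    (h1 : f 1 ≤ 1) (a : A) : ‖f a‖ ≤ 4 * ‖a‖ := by
  let g := PositiveLinearMap.mk₀ f hf
  have hone : ‖f 1‖ ≤ 1 := CStarAlgebra.norm_le_one_iff_of_nonneg (f 1) (hf 1 zero_le_one) |>.mpr h1
  have hpos : ∀ y, 0 ≤ y → ‖f y‖ ≤ ‖y‖ := fun y hy =>
    (g.norm_apply_le_of_nonneg y hy).trans (mul_le_of_le_one_left (norm_nonneg y) hone)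
  obtain ⟨y, hy0, hyn, hy⟩ := CStarAlgebra.exists_sum_four_nonneg a
  conv_lhs => rw [hy]
  simp only [map_sum, map_smul]
  refine (norm_sum_le _ _).trans ?_
  simp only [norm_smul, norm_pow, Complex.norm_I, one_pow, one_mul]
  refine (Finset.sum_le_sum fun i _ => (hpos _ (hy0 i)).trans (hyn i)).trans ?_
  simp

theorem map_star_of_nonneg {A B : VNAlg.{u}} {f : A →ₗ[ℂ] B} (hf : ∀ a, 0 ≤ a → 0 ≤ f a) (a : A) :
    f (star a) = star (f a) :=
  map_star (PositiveLinearMap.mk₀ f hf) a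

/-- A family of maps `A → C i` of a reflected class factors through a map `A → F` of the same
class, such that normal ⋆-homomorphisms out of `F` are determined by their values on the image
of `A`. -/
theorem IsReflectedClass.exists_product {P : ∀ {A B : VNAlg.{u}}, (A →ₗ[ℂ] B) → Prop}
    (hP : IsReflectedClass.{u} P) {I : Type u} {A : VNAlg.{u}} {C : I → VNAlg.{u}}
    {f : ∀ i, A →ₗ[ℂ] C i} (hf : ∀ i, P (f i)) :
    ∃ (F : VNAlg.{u}) (η : A →ₗ[ℂ] F) (π : ∀ i, NMIUHom F (C i)), P η ∧
      (∀ i a, (π i).toStarAlgHom (η a) = f i a) ∧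
      ∀ (B : VNAlg.{u}) (h₁ h₂ : NMIUHom F B),
        (∀ a, h₁.toStarAlgHom (η a) = h₂.toStarAlgHom (η a)) → h₁ = h₂ := by
  choose H _ _ _ σ hσ using fun i => (C i).exists_isVNRep
  have hbound : ∀ a i, ‖σ i (f i a)‖ ≤ 4 * ‖a‖ := fun a i =>
    (NonUnitalStarAlgHom.norm_apply_le (σ i) _).trans
      (norm_map_le_of_nonneg (hP.nonneg (hf i)) (hP.map_one_le (hf i)) a)
  let D : A →ₗ[ℂ] lp H 2 →L[ℂ] lp H 2 :=
    { toFun := fun a => lp.mapCLM 2 (fun i => σ i (f i a)) (by positivity) (hbound a)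
      map_add' := fun a b => ext_sumIncl fun i v => by
        simp [mapCLM_sumIncl]
      map_smul' := fun r a => ext_sumIncl fun i v => by
        simp [mapCLM_sumIncl] }
  have hDincl : ∀ a i v, D a (sumIncl i v) = sumIncl i (σ i (f i a) v) := fun a i v =>
    mapCLM_sumIncl (mul_nonneg zero_le_four (norm_nonneg a)) (hbound a) i v
  have hDproj : ∀ a i x, sumProj i (D a x) = σ i (f i a) (sumProj i x) := fun a i x => rfl
  have hDstar : ∀ a, star (D a) = D (star a) := by
    intro a
    refine ext_sumIncl fun i v => ext_inner_right ℂ fun x => ?_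
    rw [ContinuousLinearMap.star_eq_adjoint, ContinuousLinearMap.adjoint_inner_left, hDincl,
      inner_sumIncl_left, inner_sumIncl_left, hDproj, map_star_of_nonneg (hP.nonneg (hf i)),
      map_star, ContinuousLinearMap.star_eq_adjoint, ContinuousLinearMap.adjoint_inner_left]
  let M := VonNeumannAlgebra.generatedBy (Set.range D)
  have hDM : ∀ a, D a ∈ M := fun a => VonNeumannAlgebra.subset_generatedBy _ ⟨a, rfl⟩
  -- Taking `S = 1` shows that `M` is block-diagonal, so compression to a summand is multiplicative.
  -- General `S` shows that the compression lands in the bicommutant of `σ i`, hence in its range.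
  have hcomm : ∀ T ∈ M, ∀ i, ∀ S ∈ (Set.range (σ i)).centralizer,
      sumExtend i S * T = T * sumExtend i S := by
    intro T hT i S hS
    have hT' : T ∈ (M : Set (lp H 2 →L[ℂ] lp H 2)) := hT
    rw [VonNeumannAlgebra.coe_generatedBy] at hT'
    refine hT' _ (sumExtend_mem_centralizer hS fun x hx => ?_)
    have : ∃ a, D a = x := by
      rcases hx with ⟨a, rfl⟩ | ⟨a, ha⟩
      · exact ⟨a, rfl⟩
      · exact ⟨star a, by rw [← hDstar, ha, star_star]⟩
    obtain ⟨a, rfl⟩ := this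
    exact ⟨_, ⟨f i a, rfl⟩, hDincl a i, hDproj a i⟩
  have hblock : ∀ T ∈ M, ∀ i v, T (sumIncl i v) = sumIncl i (sumProj i (T (sumIncl i v))) := by
    intro T hT i v
    have h := DFunLike.congr_fun (hcomm T hT i 1 (fun _ _ => by rw [mul_one, one_mul])) (sumIncl i v)
    change sumIncl i (sumProj i (T (sumIncl i v))) = T (sumIncl i (sumProj i (sumIncl i v))) at h
    rw [h, sumProj_sumIncl]
  have hrep : ∀ x : M.toVNAlg, M.rep x ∈ M := fun x => by
    have : M.rep x ∈ Set.range M.rep := ⟨x, rfl⟩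
    rwa [M.range_rep] at this
  let c : ∀ i, M.toVNAlg →⋆ₐ[ℂ] (H i →L[ℂ] H i) := fun i =>
    { toFun := fun x => sumProj i ∘L M.rep x ∘L sumIncl i
      map_one' := by
        ext v
        simp [sumProj_sumIncl]
      map_mul' := fun x y => by
        ext v
        rw [map_mul]
        change sumProj i (M.rep x (M.rep y (sumIncl i v))) =
          sumProj i (M.rep x (sumIncl i (sumProj i (M.rep y (sumIncl i v)))))
        rw [← hblock _ (hrep y)]
      map_zero' := by
        ext v
        simp
      map_add' := fun x y => by
        ext v
        simp
      commutes' := fun r => by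
        ext v
        simp [sumProj_sumIncl, Algebra.algebraMap_eq_smul_one]
      map_star' := fun x => by
        rw [map_star]
        ext v
        refine ext_inner_left ℂ fun w => ?_
        rw [ContinuousLinearMap.star_eq_adjoint, ContinuousLinearMap.star_eq_adjoint,
          ContinuousLinearMap.adjoint_inner_right]
        change ⟪w, sumProj i (ContinuousLinearMap.adjoint (M.rep x) (sumIncl i v))⟫_ℂ =
          ⟪sumProj i (M.rep x (sumIncl i w)), v⟫_ℂ
        rw [← inner_sumIncl_left, ContinuousLinearMap.adjoint_inner_right, ← inner_conj_symm,
          inner_sumIncl_left, inner_conj_symm] }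
  have hc : ∀ i x, c i x = sumProj i ∘L M.rep x ∘L sumIncl i := fun i x => rfl
  have hcr : ∀ i x, c i x ∈ Set.range (σ i) := by
    intro i x
    refine (hσ i).mem_range _ fun S hS => ?_
    ext v
    have h := congrArg (sumProj i)
      (DFunLike.congr_fun (hcomm _ (hrep x) i S hS) (sumIncl i v))
    change sumProj i (sumIncl i (S (sumProj i (M.rep x (sumIncl i v))))) =
      sumProj i (M.rep x (sumIncl i (S (sumProj i (sumIncl i v))))) at h
    rw [sumProj_sumIncl, sumProj_sumIncl] at h
    exact h
  choose k hk using fun i => exists_starAlgHom_lift (c i) (σ i) (hσ i).injective (hcr i)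
  let π : ∀ i, NMIUHom M.toVNAlg (C i) := fun i =>
    ⟨k i, M.isVNRep_rep.isNormalMap_of_compression (hσ i) (k i) (sumIncl i) (sumProj i) (hk i)⟩
  let η := M.codRestrict D hDM
  have hη : ∀ i a, (π i).toStarAlgHom (η a) = f i a := by
    intro i a
    refine (hσ i).injective ((hk i (η a)).trans ?_)
    ext v
    change sumProj i (D a (sumIncl i v)) = _
    rw [hDproj, sumProj_sumIncl]
  refine ⟨M.toVNAlg, η, π, hP.reflect π (fun b hb => ?_) (fun i => ?_), hη, fun B h₁ h₂ h => ?_⟩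
  · refine M.isVNRep_rep.injective ?_
    rw [map_zero]
    refine ext_sumIncl fun i v => ?_
    rw [hblock _ (hrep b)]
    have : c i b = 0 := by
      rw [← hk i b]
      exact (congrArg (σ i) (hb i)).trans (map_zero _)
    have h2 := DFunLike.congr_fun this v
    change sumProj i (M.rep b (sumIncl i v)) = 0 at h2
    rw [h2, map_zero]
    rfl
  · have : (π i).toLin ∘ₗ η = f i := LinearMap.ext (hη i)
    rw [this]
    exact hf i
  · refine NMIUHom.ext_of_generatedBy fun x hx => ?_
    obtain ⟨a, ha⟩ := hx
    have : η a = x := M.isVNRep_rep.injective ha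
    rw [← this]
    exact h a

/-- Every von Neumann algebra has a universal map, within a reflected class, to a von Neumann
algebra. -/
theorem IsReflectedClass.exists_universal {P : ∀ {A B : VNAlg.{u}}, (A →ₗ[ℂ] B) → Prop}
    (hP : IsReflectedClass.{u} P) (A : VNAlg.{u}) :
    ∃ (F : VNAlg.{u}) (η : A →ₗ[ℂ] F), P η ∧ ∀ (B : VNAlg.{u}) (f : A →ₗ[ℂ] B), P f →
      ∃! h : NMIUHom F B, ∀ a, h.toStarAlgHom (η a) = f a := by
  let Z := Set (Set (A ⊕ ℂ))
  -- Pairs of a code and a map into `Z` form a type in universe `u`. One target is chosen for each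
  -- realized pair, which covers all small targets up to an isomorphism compatible with the maps
  -- from `A`.
  let I := {k : ((Z → Z → Z → Prop) × (Z → Z → Z → Prop) × (Z → Z → Prop) × (ℂ → Z → Z → Prop) × Z)
    × (A → Z) // ∃ (C : VNAlg.{u}) (e : C → Z) (c : A →ₗ[ℂ] C),
      Function.Injective e ∧ P c ∧ k = (C.code e, fun a => e (c a))}
  choose C e c he hc hcode using fun i : I => i.2
  obtain ⟨F, η, π, hη, hπ, huniq⟩ := hP.exists_product hc
  refine ⟨F, η, hη, fun B f hf => ?_⟩
  obtain ⟨C', c', h', hc', hcard, hfac⟩ := hP.exists_factorization hf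
  obtain ⟨⟨e', he'⟩⟩ := hcard
  let i : I := ⟨(C'.code e', fun a => e' (c' a)), C', e', c', he', hc', rfl⟩
  have hi := hcode i
  obtain ⟨k, hk⟩ := VNAlg.exists_nmiuHom_of_code_eq (he i) he' (congrArg Prod.fst hi).symm
  have hkc : ∀ a, k.toStarAlgHom (c i a) = c' a := fun a =>
    he' ((hk _).trans (congrFun (congrArg Prod.snd hi) a).symm)
  refine ⟨h'.comp (k.comp (π i)), fun a => ?_, fun h hh => huniq B _ _ fun a => ?_⟩
  · change h'.toStarAlgHom (k.toStarAlgHom ((π i).toStarAlgHom (η a))) = f a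
    rw [hπ, hkc, hfac]
  · change h.toStarAlgHom (η a) =
      h'.toStarAlgHom (k.toStarAlgHom ((π i).toStarAlgHom (η a)))
    rw [hh, hπ, hkc, hfac]

end Universal

/-! ### The main theorem -/

theorem inclNPU_isRightAdjoint : inclNPU.{u}.IsRightAdjoint := by
  refine isRightAdjoint_of_universal_arrows _ fun A => ?_
  obtain ⟨F, η, hη, huniv⟩ := IsNPU.isReflectedClass.exists_universal A
  refine ⟨F, hη.toHom, fun B f => ?_⟩
  obtain ⟨h, hh, huniq⟩ := huniv B _ (NPUHom.isNPU f)
  exact ⟨h, NPUHom.ext hh, fun k hk => huniq k fun a =>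
    congrArg (fun g : NPUHom A B => g.toPositiveLinearMap a) hk⟩

theorem inclNCPsU_isRightAdjoint : inclNCPsU.{u}.IsRightAdjoint := by
  refine isRightAdjoint_of_universal_arrows _ fun A => ?_
  obtain ⟨F, η, hη, huniv⟩ := IsNCPsU.isReflectedClass.exists_universal A
  refine ⟨F, hη.toHom, fun B f => ?_⟩
  obtain ⟨h, hh, huniq⟩ := huniv B _ (NCPsUHom.isNCPsU f)
  exact ⟨h, NCPsUHom.ext hh, fun k hk => huniq k fun a =>
    congrArg (fun g : NCPsUHom A B => g.toCompletelyPositiveMap a) hk⟩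

/-- A nontrivial von Neumann algebra absorbs the scalars in cardinality. -/
theorem mk_set_set_sum_complex (A : VNAlg.{u}) [Nontrivial A] :
    Cardinal.mk (Set (Set (A ⊕ ℂ))) = Cardinal.mk (Set (Set A)) := by
  have hinj : Function.Injective fun z : ℂ => z • (1 : A) := smul_left_injective ℂ one_ne_zero
  have hle : Cardinal.lift.{u} (Cardinal.mk ℂ) ≤ Cardinal.mk A := by
    simpa using Cardinal.lift_mk_le_lift_mk_of_injective hinj
  have hinf : Cardinal.aleph0 ≤ Cardinal.mk A :=
    Cardinal.aleph0_le_mk_iff.mpr (Infinite.of_injective _ hinj)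
  have hsum : Cardinal.mk (A ⊕ ℂ) = Cardinal.mk A := by
    rw [Cardinal.mk_sum, Cardinal.lift_uzero, Cardinal.add_eq_left hinf hle]
  simp only [Cardinal.mk_set, hsum]

theorem mainTheorem4 :
    -- the inclusions have left adjoints, and their opposites are Kleislian functors
    (inclNPU.{u}.IsRightAdjoint ∧ IsKleislian inclNPU.{u}.op) ∧
    (inclNCPsU.{u}.IsRightAdjoint ∧ IsKleislian inclNCPsU.{u}.op) ∧
    IsKleislianOver (WNMIU.{u})ᵒᵖ (WNPU.{u})ᵒᵖ ∧
    IsKleislianOver (WNMIU.{u})ᵒᵖ (WNCPsU.{u})ᵒᵖ ∧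
    -- the cardinality of the smallest von Neumann subalgebra containing `X`
    (∀ (H : Type u) [NormedAddCommGroup H] [InnerProductSpace ℂ H] [CompleteSpace H]
      (B : VonNeumannAlgebra H) (X : Set (H →L[ℂ] H)), X ⊆ B → X.Infinite →
      ∃ B' : VonNeumannAlgebra H,
        IsLeast {M : VonNeumannAlgebra H | M ≤ B ∧ X ⊆ M} B' ∧
        Cardinal.mk (B' : Set (H →L[ℂ] H)) ≤ Cardinal.mk (Set (Set X))) ∧
    -- the solution sets
    (∀ (A : WNPU.{u}) (B : WNMIU.{u}) (f : A ⟶ inclNPU.obj B),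
      ∃ (C : WNMIU.{u}) (c : A ⟶ inclNPU.obj C) (h : C ⟶ B),
        Cardinal.mk C ≤ Cardinal.mk (Set (Set A)) ∧ c ≫ inclNPU.map h = f) ∧
    (∀ (A : WNCPsU.{u}) (B : WNMIU.{u}) (f : A ⟶ inclNCPsU.obj B), Nontrivial A →
      ∃ (C : WNMIU.{u}) (c : A ⟶ inclNCPsU.obj C) (h : C ⟶ B),
        Cardinal.mk C ≤ Cardinal.mk (Set (Set A)) ∧ c ≫ inclNCPsU.map h = f) := by
  have h₁ := inclNPU_isRightAdjoint.{u}
  have h₂ := inclNCPsU_isRightAdjoint.{u}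
  have k₁ : IsKleislian inclNPU.{u}.op :=
    isKleislian_op_of_isRightAdjoint _ (fun A => A) (fun _ => rfl) fun _ => rfl
  have k₂ : IsKleislian inclNCPsU.{u}.op :=
    isKleislian_op_of_isRightAdjoint _ (fun A => A) (fun _ => rfl) fun _ => rfl
  refine ⟨⟨h₁, k₁⟩, ⟨h₂, k₂⟩, ⟨_, k₁⟩, ⟨_, k₂⟩, ?_, ?_, ?_⟩
  · intro H _ _ _ B X hXB hX
    exact ⟨_, VonNeumannAlgebra.isLeast_generatedBy hXB, VonNeumannAlgebra.mk_generatedBy_le hX⟩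
  · intro (A : VNAlg.{u}) (B : VNAlg.{u}) (f : NPUHom A B)
    -- For `A = 0` unitality forces `B = 0`, so `C = B` works. A subunital map may go from `0` to a
    -- nonzero `B`; then `C` contains a copy of `ℂ`, too large for the finite bound.
    rcases subsingleton_or_nontrivial A with hA | hA
    · refine ⟨B, f, NMIUHom.id B, ?_, rfl⟩
      have hB : Subsingleton B := by
        refine subsingleton_of_zero_eq_one ?_
        have h0 : f.toLinearMap 0 = 0 := map_zero _
        rw [← h0, Subsingleton.elim (0 : A) 1]
        exact f.isNPU.map_one
      exact (Cardinal.le_one_iff_subsingleton.mpr hB).trans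
        (Cardinal.one_le_iff_ne_zero.mpr (Cardinal.mk_ne_zero _))
    · obtain ⟨C, c, h, hc, hcard, hfac⟩ := IsNPU.isReflectedClass.exists_factorization f.isNPU
      rw [mk_set_set_sum_complex] at hcard
      exact ⟨C, hc.toHom, h, hcard, NPUHom.ext hfac⟩
  · intro (A : VNAlg.{u}) (B : VNAlg.{u}) (f : NCPsUHom A B) (hA : Nontrivial A)
    obtain ⟨C, c, h, hc, hcard, hfac⟩ := IsNCPsU.isReflectedClass.exists_factorization f.isNCPsU
    rw [mk_set_set_sum_complex] at hcard
    exact ⟨C, hc.toHom, h, hcard, NCPsUHom.ext hfac⟩
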